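/- Work over $\mathbb{C}$. A combinatorial Hopf algebra $(H,\zeta)$ is a connected graded Hopf algebra $H=\bigoplus_{n\ge 0}H_n$ with a character (algebra morphism) $\zeta\colon H\to\mathbb{C}$; a morphism $(H,\zeta)\to(H',\zeta')$ is a graded Hopf morphism $f$ with $\zeta'\circ f=\zeta$. For characters, $\zeta\zeta'=m\circ(\zeta\otimes\zeta')\circ\Delta$ is the convolution product, $\zeta^{-1}=\zeta\circ S$ its inverse ($S$ the antipode), and $\overline{\zeta}=(-1)^n\zeta$ on $H_n$. Let $\mathrm{QSym}$ be the Hopf algebra of quasisymmetric functions, with basis $M_\alpha=\sum_{i_1<\cdots<i_\ell}x_{i_1}^{\alpha_1}\cdots x_{i_\ell}^{\alpha_\ell}$ ($\alpha$ a composition), coproduct $\Delta M_\alpha=\sum_{\alpha=\beta\gamma}M_\beta\otimes M_\gamma$ (deconcatenation), and character $\zeta_{\mathrm{QSym}}(f)=f(1,0,0,\dots)$. Let $\mathrm{Sym}\subset\mathrm{QSym}$ be the Hopf subalgebra of symmetric functions, $\zeta_{\mathrm{Sym}}$ the restriction of $\zeta_{\mathrm{QSym}}$, and $p_n=\frac1n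 M_{(n)}$. For $H\in\{\mathrm{QSym},\mathrm{Sym}\}$ let $\Theta_H$ be the unique morphism of combinatorial Hopf algebras $(H,\overline{\zeta_H^{-1}}\,\zeta_H)\to(H,\zeta_H)$, and let $\Omega=\Theta_{\mathrm{Sym}}(\mathrm{Sym})$. A theta map for $(H,\zeta)$ is a graded Hopf morphism $\Theta\colon H\to H$ with $\Phi\circ\Theta=\Theta_{\mathrm{QSym}}\circ\Phi$, where $\Phi\colon(H,\zeta)\to(\mathrm{QSym},\zeta_{\mathrm{QSym}})$ is the unique morphism of combinatorial Hopf algebras; the image of a theta map is called a peak algebra for $(H,\zeta)$. Let $V$ be a graded complex vector space with a basis $\{v_i\}_{i\in I}$ of homogeneous elements of positive degrees, such that for each $n$ only finitely many words $v_\alpha=v_{\alpha_1}v_{\alpha_2}\cdots v_{\alpha_\ell}$ in the basis have degree $\deg v_\alpha=\sum_j\deg v_{\alpha_j}=n$; write $\ell(\alpha)=\ell$, and let $\overline{v_\alpha}$ be the image of $v_\alpha$ in the symmetric algebra $\mathrm{Sym}(V)$. Then $\mathrm{Sym}(V)$ is a connected graded Hopf algebra with the elements of $V$ primitive and $\deg\overline{v_\alpha}=\deg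 v_\alpha$. Let $\Phi_{\mathrm{Sym}(V)}\colon\mathrm{Sym}(V)\to\mathrm{Sym}$ be the algebra morphism with $v_i\mapsto p_{\deg v_i}$, and let $\zeta_{\mathrm{Sym}(V)}$ be the character with $v_i\mapsto 1/\deg v_i$. Call $\alpha$ odd if all its letters $v_{\alpha_j}$ have odd degree (the empty word is odd), let $\mathrm{Sym}(\mathrm{O}(V))$ be the span of the $\overline{v_\alpha}$ with $\alpha$ odd, and let $\Theta_{\mathrm{Sym}(V)}\colon\mathrm{Sym}(V)\to\mathrm{Sym}(V)$ be the linear map with $\overline{v_\alpha}\mapsto 2^{\ell(\alpha)}\,\overline{v_\alpha}$ if $\alpha$ is odd and $\overline{v_\alpha}\mapsto 0$ otherwise. **Theorem.** $\Theta_{\mathrm{Sym}(V)}$ is a graded Hopf morphism with image $\mathrm{Sym}(\mathrm{O}(V))$. Moreover $\Theta_{\mathrm{Sym}}$ exists and is unique, $\Phi_{\mathrm{Sym}(V)}$ maps $\mathrm{Sym}(\mathrm{O}(V))$ into $\Omega$, and $$\Theta_{\mathrm{Sym}}\circ\Phi_{\mathrm{Sym}(V)}=\Phi_{\mathrm{Sym}(V)}\circ\Theta_{\mathrm{Sym}(V)}.$$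 Consequently the unique morphisms $\Phi$ and $\Theta_{\mathrm{QSym}}$ exist and $\Theta_{\mathrm{Sym}(V)}$ is a theta map for $(\mathrm{Sym}(V),\zeta_{\mathrm{Sym}(V)})$, with peak algebra $\mathrm{Sym}(\mathrm{O}(V))$. -/

import Mathlib

open scoped TensorProduct DirectSum

noncomputable section

namespace PeakTheta

section Graded

variable {H : Type*} [Ring H] [Bialgebra ℂ H]

/-- The degree `n` part `⨁_{i+j=n} H_i ⊗ H_j` of `H ⊗ H`. -/
def tensorDegree (𝒜 : ℕ → Submodule ℂ H) (n : ℕ) : Submodule ℂ (H ⊗[ℂ] H) :=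
  ⨆ p : {p : ℕ × ℕ // p.1 + p.2 = n},
    LinearMap.range (TensorProduct.map (𝒜 p.1.1).subtype (𝒜 p.1.2).subtype)

/-- `H = ⨁ₙ H_n` is a connected graded bialgebra (a connected graded Hopf algebra when `H` has an
antipode): it is a graded algebra, `H_0` consists of the scalars, and the coproduct and the counit
preserve degrees. -/
class ConnectedGraded (𝒜 : ℕ → Submodule ℂ H) [GradedAlgebra 𝒜] : Prop where
  connected : 𝒜 0 = 1
  comul_mem : ∀ n, ∀ x ∈ 𝒜 n, Coalgebra.comul (R := ℂ) x ∈ tensorDegree 𝒜 n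
  counit_eq : ∀ n, n ≠ 0 → ∀ x ∈ 𝒜 n, Coalgebra.counit (R := ℂ) x = 0

theorem tensorDegree_le {𝒜 : ℕ → Submodule ℂ H} {n : ℕ} {S : Submodule ℂ (H ⊗[ℂ] H)}
    (h : ∀ i j, i + j = n → ∀ a ∈ 𝒜 i, ∀ b ∈ 𝒜 j, a ⊗ₜ[ℂ] b ∈ S) : tensorDegree 𝒜 n ≤ S := by
  refine iSup_le ?_
  rintro ⟨⟨i, j⟩, hp⟩
  rintro _ ⟨t, rfl⟩
  induction t with
  | zero => simp
  | add x y hx hy => rw [map_add]; exact S.add_mem hx hy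
  | tmul a b => exact h i j hp _ a.2 _ b.2

theorem tmul_mem_tensorDegree {𝒜 : ℕ → Submodule ℂ H} {i j n : ℕ} (hn : i + j = n) {a b : H}
    (ha : a ∈ 𝒜 i) (hb : b ∈ 𝒜 j) : a ⊗ₜ[ℂ] b ∈ tensorDegree 𝒜 n := by
  refine Submodule.mem_iSup_of_mem ⟨(i, j), hn⟩ ?_
  exact ⟨(⟨a, ha⟩ : 𝒜 i) ⊗ₜ (⟨b, hb⟩ : 𝒜 j), by simp⟩

theorem mul_mem_tensorDegree {𝒜 : ℕ → Submodule ℂ H} [SetLike.GradedMonoid 𝒜] {m n : ℕ}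
    {x y : H ⊗[ℂ] H} (hx : x ∈ tensorDegree 𝒜 m) (hy : y ∈ tensorDegree 𝒜 n) :
    x * y ∈ tensorDegree 𝒜 (m + n) := by
  have h1 : tensorDegree 𝒜 m ≤
      (tensorDegree 𝒜 (m + n)).comap (LinearMap.mulRight ℂ y) := by
    refine tensorDegree_le fun i j hij a ha b hb => ?_
    have h2 : tensorDegree 𝒜 n ≤
        (tensorDegree 𝒜 (m + n)).comap (LinearMap.mulLeft ℂ (a ⊗ₜ[ℂ] b)) := by
      refine tensorDegree_le fun i' j' hij' c hc d hd => ?_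
      simp only [Submodule.mem_comap, LinearMap.mulLeft_apply,
        Algebra.TensorProduct.tmul_mul_tmul]
      exact tmul_mem_tensorDegree (by omega) (SetLike.mul_mem_graded ha hc)
        (SetLike.mul_mem_graded hb hd)
    exact h2 hy
  exact h1 hx

section Antipode

open WithConv

/-- The identity minus the convolution unit. -/
def convU (H : Type*) [Ring H] [Bialgebra ℂ H] : WithConv (H →ₗ[ℂ] H) := toConv LinearMap.id - 1

/-- Partial sums of the series `∑ (-1)ᵏ (id - ηε)ᵏ` for the antipode. -/
def antipodeSum (H : Type*) [Ring H] [Bialgebra ℂ H] (N : ℕ) : WithConv (H →ₗ[ℂ] H) :=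
  ∑ k ∈ Finset.range N, (-convU H) ^ k

variable (𝒜 : ℕ → Submodule ℂ H) [GradedAlgebra 𝒜] [ConnectedGraded 𝒜]

theorem convU_zero {x : H} (hx : x ∈ 𝒜 0) : (-convU H).ofConv x = 0 := by
  rw [ConnectedGraded.connected (𝒜 := 𝒜)] at hx
  obtain ⟨c, rfl⟩ := Submodule.mem_one.1 hx
  simp [convU, LinearMap.convOne_def]

theorem convU_pow {n : ℕ} : ∀ {m : ℕ}, m < n → ∀ x ∈ 𝒜 m, ((-convU H) ^ n).ofConv x = 0 := by
  induction n with
  | zero => intro m hm; omega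
  | succ n ih =>
    intro m hm x hx
    rw [pow_succ', LinearMap.convMul_def]
    have h : tensorDegree 𝒜 m ≤ LinearMap.ker
        (TensorProduct.map (-convU H).ofConv ((-convU H) ^ n).ofConv) := by
      refine tensorDegree_le fun i j hij a ha b hb => ?_
      rw [LinearMap.mem_ker, TensorProduct.map_tmul]
      rcases Nat.eq_zero_or_pos i with rfl | hi
      · rw [convU_zero 𝒜 ha, TensorProduct.zero_tmul]
      · rw [ih (m := j) (by omega) b hb, TensorProduct.tmul_zero]
    have h2 := LinearMap.mem_ker.1 (h (ConnectedGraded.comul_mem m x hx))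
    simp only [LinearMap.comp_apply, h2, map_zero]

theorem antipodeSum_stable {m N : ℕ} (h : m < N) {x : H} (hx : x ∈ 𝒜 m) :
    (antipodeSum H N).ofConv x = (antipodeSum H (m + 1)).ofConv x := by
  induction N, h using Nat.le_induction with
  | base => rfl
  | succ N hN ih =>
    rw [← ih]
    have : antipodeSum H (N + 1) = antipodeSum H N + (-convU H) ^ N := Finset.sum_range_succ _ _
    rw [this, WithConv.ofConv_add, LinearMap.add_apply, convU_pow 𝒜 hN x hx, add_zero]

/-- The antipode `∑ (-1)ᵏ (id - ηε)ᵏ`, a finite sum in each degree. -/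
def connectedAntipode : H →ₗ[ℂ] H :=
  (DirectSum.toModule ℂ ℕ H fun m => (antipodeSum H (m + 1)).ofConv ∘ₗ (𝒜 m).subtype) ∘ₗ
    (DirectSum.decomposeLinearEquiv 𝒜).toLinearMap

theorem connectedAntipode_apply {m N : ℕ} (h : m < N) {x : H} (hx : x ∈ 𝒜 m) :
    connectedAntipode 𝒜 x = (antipodeSum H N).ofConv x := by
  rw [antipodeSum_stable 𝒜 h hx]
  lift x to 𝒜 m using hx
  rw [connectedAntipode, LinearMap.comp_apply, LinearEquiv.coe_coe,
    DirectSum.decomposeLinearEquiv_apply_coe]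
  simp

/-- A connected graded bialgebra is a Hopf algebra. -/
@[reducible]
def hopfOfConnected : HopfAlgebra ℂ H where
  antipode := connectedAntipode 𝒜
  mul_antipode_rTensor_comul := by
    ext x
    induction x using DirectSum.Decomposition.inductionOn 𝒜 with
    | zero => simp
    | add x y hx hy => simp only [map_add] at hx hy ⊢; rw [hx, hy]
    | @homogeneous m x =>
      have h : tensorDegree 𝒜 m ≤ LinearMap.eqLocus ((connectedAntipode 𝒜).rTensor H)
          (TensorProduct.map (antipodeSum H (m + 1)).ofConv LinearMap.id) := by
        refine tensorDegree_le fun i j hij a ha b hb => ?_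
        simp only [LinearMap.mem_eqLocus, LinearMap.rTensor_tmul, TensorProduct.map_tmul]
        rw [connectedAntipode_apply 𝒜 (N := m + 1) (by omega) ha]; rfl
      have h2 := h (ConnectedGraded.comul_mem m (x : H) x.2)
      rw [LinearMap.mem_eqLocus] at h2
      have h3 : antipodeSum H (m + 1) * toConv LinearMap.id = 1 - (-convU H) ^ (m + 1) := by
        rw [← geom_sum_mul_neg, antipodeSum]
        simp [convU]
      have h4 := congrArg (fun f => f.ofConv (x : H)) h3
      simp only [WithConv.ofConv_sub, LinearMap.sub_apply,
        convU_pow 𝒜 (Nat.lt_succ_self m) x x.2, sub_zero] at h4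
      simp only [LinearMap.comp_apply, h2]
      exact h4
  mul_antipode_lTensor_comul := by
    ext x
    induction x using DirectSum.Decomposition.inductionOn 𝒜 with
    | zero => simp
    | add x y hx hy => simp only [map_add] at hx hy ⊢; rw [hx, hy]
    | @homogeneous m x =>
      have h : tensorDegree 𝒜 m ≤ LinearMap.eqLocus ((connectedAntipode 𝒜).lTensor H)
          (TensorProduct.map LinearMap.id (antipodeSum H (m + 1)).ofConv) := by
        refine tensorDegree_le fun i j hij a ha b hb => ?_
        simp only [LinearMap.mem_eqLocus, LinearMap.lTensor_tmul, TensorProduct.map_tmul]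
        rw [connectedAntipode_apply 𝒜 (N := m + 1) (by omega) hb]; rfl
      have h2 := h (ConnectedGraded.comul_mem m (x : H) x.2)
      rw [LinearMap.mem_eqLocus] at h2
      have h3 : toConv LinearMap.id * antipodeSum H (m + 1) = 1 - (-convU H) ^ (m + 1) := by
        rw [← mul_neg_geom_sum, antipodeSum]
        simp [convU]
      have h4 := congrArg (fun f => f.ofConv (x : H)) h3
      simp only [WithConv.ofConv_sub, LinearMap.sub_apply,
        convU_pow 𝒜 (Nat.lt_succ_self m) x x.2, sub_zero] at h4
      simp only [LinearMap.comp_apply, h2]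
      exact h4

end Antipode

end Graded

section BasisGrading

variable {κ H : Type*} [Ring H] [Algebra ℂ H] (b : Module.Basis κ ℂ H) (w : κ → ℕ)

/-- The span of the basis vectors of weight `n`. -/
def weightSpan (n : ℕ) : Submodule ℂ H := Submodule.span ℂ {x | ∃ k, w k = n ∧ b k = x}

theorem basis_mem_weightSpan (k : κ) : b k ∈ weightSpan b w (w k) :=
  Submodule.subset_span ⟨k, rfl, rfl⟩

theorem mem_weightSpan {n : ℕ} {x : H} : x ∈ weightSpan b w n ↔ ∀ k, b.repr x k ≠ 0 → w k = n := by
  have : {x | ∃ k, w k = n ∧ b k = x} = b '' {k | w k = n} := rfl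
  rw [weightSpan, this, b.mem_span_image]
  constructor
  · intro h k hk
    exact h (Finsupp.mem_support_iff.2 hk)
  · intro h k hk
    exact h k (Finsupp.mem_support_iff.1 hk)

/-- A basis of homogeneous vectors decomposes the space. -/
@[reducible]
def weightDecomposition : DirectSum.Decomposition (weightSpan b w) :=
  DirectSum.Decomposition.ofLinearMap (weightSpan b w)
    (b.constr ℂ fun k => DirectSum.lof ℂ ℕ (fun n => weightSpan b w n) (w k)
      ⟨b k, basis_mem_weightSpan b w k⟩)
    (b.ext fun k => by simp)
    (by
      ext n ⟨x, hx⟩ : 2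
      simp only [LinearMap.comp_apply, DirectSum.coeLinearMap_lof, LinearMap.id_apply]
      induction hx using Submodule.span_induction with
      | mem x hx => obtain ⟨k, rfl, rfl⟩ := hx; simp
      | zero =>
        rw [map_zero]
        exact (map_zero (DirectSum.lof ℂ ℕ (fun n => weightSpan b w n) n)).symm
      | add x y hx hy h1 h2 =>
        rw [map_add, h1, h2, ← map_add]; rfl
      | smul c x hx h =>
        rw [map_smul, h, ← map_smul]; rfl)

theorem weightSpan_zero {k₀ : κ} (h1 : b k₀ = 1) (h : ∀ k, w k = 0 ↔ k = k₀) :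
    weightSpan b w 0 = 1 := by
  have : {x | ∃ k, w k = 0 ∧ b k = x} = {1} := by
    ext x
    constructor
    · rintro ⟨k, hk, rfl⟩
      rw [(h k).1 hk]; exact h1
    · rintro rfl
      exact ⟨k₀, (h k₀).2 rfl, h1⟩
  rw [weightSpan, this, Submodule.one_eq_span]

end BasisGrading

section BasisCoalgebra

variable {κ : Type*} {C : Type*} [AddCommGroup C] [Module ℂ C]

/-- A monoid operation on an index set in which every element has finitely many factorizations. -/
structure Factorization (κ : Type*) where
  op : κ → κ → κ
  e : κ
  op_assoc : ∀ a b c, op (op a b) c = op a (op b c)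
  e_op : ∀ a, op e a = a
  op_e : ∀ a, op a e = a
  div : κ → Finset (κ × κ)
  mem_div : ∀ k p, p ∈ div k ↔ op p.1 p.2 = k

variable (b : Module.Basis κ ℂ C) (F : Factorization κ)

/-- The coproduct `b_k ↦ ∑_{ij = k} b_i ⊗ b_j`. -/
def basisComul : C →ₗ[ℂ] C ⊗[ℂ] C :=
  b.constr ℂ fun k => ∑ p ∈ F.div k, b p.1 ⊗ₜ b p.2

@[simp]
theorem basisComul_basis (k : κ) : basisComul b F (b k) = ∑ p ∈ F.div k, b p.1 ⊗ₜ b p.2 := by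
  simp [basisComul]

theorem basisComul_repr (x : C) (i j : κ) :
    (b.tensorProduct b).repr (basisComul b F x) (i, j) = b.repr x (F.op i j) := by
  classical
  let f : C →ₗ[ℂ] ℂ := ((b.tensorProduct b).coord (i, j)) ∘ₗ basisComul b F
  suffices f = b.coord (F.op i j) from congrArg (fun g => g x) this
  refine b.ext fun k => ?_
  have h : ∀ p : κ × κ, b.repr (b p.2) j * b.repr (b p.1) i = if p = (i, j) then 1 else 0 := by
    rintro ⟨p, q⟩
    simp only [Module.Basis.repr_self, Finsupp.single_apply, Prod.mk.injEq]
    split_ifs <;> simp_all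
  have h2 : f (b k) = ∑ p ∈ F.div k, b.repr (b p.2) j * b.repr (b p.1) i := by
    simp only [f, LinearMap.comp_apply, basisComul_basis, map_sum, Module.Basis.coord_apply,
      Module.Basis.tensorProduct_repr_tmul_apply, smul_eq_mul]
  rw [h2, Finset.sum_congr rfl fun p _ => h p, Finset.sum_ite_eq', Module.Basis.coord_apply,
    Module.Basis.repr_self, Finsupp.single_apply]
  simp only [F.mem_div, eq_comm]

theorem basisComul_rTensor (t : C ⊗[ℂ] C) (i j k : κ) :
    ((b.tensorProduct b).tensorProduct b).repr ((basisComul b F).rTensor C t) ((i, j), k) =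
      (b.tensorProduct b).repr t (F.op i j, k) := by
  induction t with
  | zero => simp
  | add x y hx hy => simp only [map_add, Finsupp.add_apply, hx, hy]
  | tmul x y =>
    rw [LinearMap.rTensor_tmul, Module.Basis.tensorProduct_repr_tmul_apply,
      Module.Basis.tensorProduct_repr_tmul_apply, basisComul_repr]

theorem basisComul_lTensor (t : C ⊗[ℂ] C) (i j k : κ) :
    (b.tensorProduct (b.tensorProduct b)).repr ((basisComul b F).lTensor C t) (i, (j, k)) =
      (b.tensorProduct b).repr t (i, F.op j k) := by
  induction t with
  | zero => simp
  | add x y hx hy => simp only [map_add, Finsupp.add_apply, hx, hy]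
  | tmul x y =>
    rw [LinearMap.lTensor_tmul, Module.Basis.tensorProduct_repr_tmul_apply,
      Module.Basis.tensorProduct_repr_tmul_apply, basisComul_repr]

theorem basis_assoc (t : (C ⊗[ℂ] C) ⊗[ℂ] C) (i j k : κ) :
    (b.tensorProduct (b.tensorProduct b)).repr (TensorProduct.assoc ℂ C C C t) (i, (j, k)) =
      ((b.tensorProduct b).tensorProduct b).repr t ((i, j), k) := by
  induction t with
  | zero => simp
  | add x y hx hy => simp only [map_add, Finsupp.add_apply, hx, hy]
  | tmul s z =>
    induction s with
    | zero => simp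
    | add x y hx hy => simp only [TensorProduct.add_tmul, map_add, Finsupp.add_apply, hx, hy]
    | tmul x y =>
      simp only [TensorProduct.assoc_tmul, Module.Basis.tensorProduct_repr_tmul_apply, smul_eq_mul]
      ring

/-- The coalgebra with `Δ b_k = ∑_{ij = k} b_i ⊗ b_j` and `ε b_k = 0` unless `k` is the unit. -/
@[reducible]
def basisCoalgebra : Coalgebra ℂ C where
  comul := basisComul b F
  counit := b.coord F.e
  coassoc := by
    ext x
    refine (b.tensorProduct (b.tensorProduct b)).ext_elem ?_
    rintro ⟨i, j, k⟩
    simp only [LinearMap.comp_apply, LinearEquiv.coe_coe]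
    rw [basis_assoc, basisComul_rTensor, basisComul_lTensor, basisComul_repr, basisComul_repr,
      F.op_assoc]
  rTensor_counit_comp_comul := by
    refine LinearMap.ext fun x => ?_
    refine ((Module.Basis.singleton Unit ℂ).tensorProduct b).ext_elem ?_
    rintro ⟨⟨⟩, j⟩
    have : ∀ t : C ⊗[ℂ] C, ((Module.Basis.singleton Unit ℂ).tensorProduct b).repr
        ((b.coord F.e).rTensor C t) ((), j) = (b.tensorProduct b).repr t (F.e, j) := by
      intro t
      induction t with
      | zero => simp
      | add x y hx hy => simp only [map_add, Finsupp.add_apply, hx, hy]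
      | tmul x y => simp
    rw [LinearMap.comp_apply, this, basisComul_repr, F.e_op]
    simp
  lTensor_counit_comp_comul := by
    refine LinearMap.ext fun x => ?_
    refine (b.tensorProduct (Module.Basis.singleton Unit ℂ)).ext_elem ?_
    rintro ⟨j, ⟨⟩⟩
    have : ∀ t : C ⊗[ℂ] C, (b.tensorProduct (Module.Basis.singleton Unit ℂ)).repr
        ((b.coord F.e).lTensor C t) (j, ()) = (b.tensorProduct b).repr t (j, F.e) := by
      intro t
      induction t with
      | zero => simp
      | add x y hx hy => simp only [map_add, Finsupp.add_apply, hx, hy]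
      | tmul x y => simp
    rw [LinearMap.comp_apply, this, basisComul_repr, F.op_e]
    simp

end BasisCoalgebra

section QuasiSymmetric

open MvPowerSeries

/-- The nonzero exponents of the monomial `x^m`, in the order of the variables. -/
def exps {σ : Type*} [LinearOrder σ] (m : σ →₀ ℕ) : List ℕ := m.support.sort.map m

theorem exps_emb {σ τ : Type*} [LinearOrder σ] [LinearOrder τ] (e : σ ↪o τ) (m : σ →₀ ℕ) :
    exps (m.embDomain e.toEmbedding) = exps m := by
  unfold exps
  have h : m.support.sort.map e = (m.support.map e.toEmbedding).sort :=
    StrictMonoOn.map_finsetSort e.toEmbedding m.support (e.strictMono.strictMonoOn _)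
  rw [Finsupp.support_embDomain, ← h, List.map_map]
  refine List.map_congr_left fun i _ => ?_
  exact Finsupp.embDomain_apply_self e.toEmbedding m i

theorem exps_pos {σ : Type*} [LinearOrder σ] (m : σ →₀ ℕ) : ∀ n ∈ exps m, 0 < n := by
  intro n hn
  obtain ⟨i, hi, rfl⟩ := List.mem_map.1 hn
  exact Nat.pos_of_ne_zero (Finsupp.mem_support_iff.1 ((Finset.mem_sort _).1 hi))

theorem exists_comp {σ : Type*} [LinearOrder σ] (m : σ →₀ ℕ) :
    ∃ α : List ℕ+, α.map PNat.val = exps m := by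
  have h := exps_pos m
  generalize exps m = L at h
  induction L with
  | nil => exact ⟨[], rfl⟩
  | cons a L ih =>
    obtain ⟨α, hα⟩ := ih fun n hn => h n (List.mem_cons_of_mem _ hn)
    refine ⟨a.toPNat (h a List.mem_cons_self) :: α, ?_⟩
    rw [List.map_cons, hα]
    rfl

theorem sum_exps {σ : Type*} [LinearOrder σ] (m : σ →₀ ℕ) : (exps m).sum = m.degree := by
  rw [exps, ← Multiset.sum_coe, ← Multiset.map_coe, Finset.sort_eq]
  rfl

theorem coe_exps {σ : Type*} [LinearOrder σ] (m : σ →₀ ℕ) :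
    (exps m : Multiset ℕ) = m.support.val.map m := by
  rw [exps, ← Multiset.map_coe, Finset.sort_eq]

/-- The exponent vector `x_0^{α_1} x_1^{α_2} ⋯` of a composition. -/
def ofComp (α : List ℕ+) : ℕ →₀ ℕ := (α.map PNat.val).toFinsupp

theorem ofComp_support (α : List ℕ+) : (ofComp α).support = Finset.range α.length := by
  rw [ofComp, List.toFinsupp_support]
  ext i
  simp only [Finset.mem_filter, Finset.mem_range, List.length_map, and_iff_left_iff_imp]
  intro hi
  rw [List.getD_eq_getElem _ _ (by simpa using hi)]
  simp

theorem exps_ofComp (α : List ℕ+) : exps (ofComp α) = α.map PNat.val := by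
  rw [exps, ofComp_support, Finset.sort_range]
  refine List.ext_getElem (by simp) fun i h1 h2 => ?_
  simp only [List.getElem_map, List.getElem_range, ofComp, List.toFinsupp_apply]
  rw [List.getD_eq_getElem _ _ h2, List.getElem_map]

theorem map_coe_inj {α β : List ℕ+} :
    α.map PNat.val = β.map PNat.val ↔ α = β :=
  (List.map_injective_iff.2 PNat.coe_injective).eq_iff

/-- A power series has bounded degree. -/
def BoundedDegree (f : MvPowerSeries ℕ ℂ) : Prop := ∃ N, ∀ m, coeff m f ≠ 0 → m.degree ≤ N

/-- For `i_1 < ⋯ < i_k` and `j_1 < ⋯ < j_k`, the coefficients of `x_{i_1}^{a_1} ⋯ x_{i_k}^{a_k}` and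
`x_{j_1}^{a_1} ⋯ x_{j_k}^{a_k}` in `f` agree. -/
def IsQuasiSymmetric (f : MvPowerSeries ℕ ℂ) : Prop :=
  ∀ (k : ℕ) (i j : Fin k ↪o ℕ) (a : Fin k →₀ ℕ),
    coeff (a.embDomain i.toEmbedding) f = coeff (a.embDomain j.toEmbedding) f

theorem isQuasiSymmetric_iff {f : MvPowerSeries ℕ ℂ} : IsQuasiSymmetric f ↔
    ∀ (k : ℕ) (i j : Fin k ↪o ℕ), killCompl i.toEmbedding f = killCompl j.toEmbedding f := by
  refine forall_congr' fun k => forall_congr' fun i => forall_congr' fun j => ?_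
  rw [MvPowerSeries.ext_iff]
  rfl

/-- The algebra of quasisymmetric functions in the variables `x_0, x_1, …`. -/
def QSym : Subalgebra ℂ (MvPowerSeries ℕ ℂ) where
  carrier := {f | BoundedDegree f ∧ IsQuasiSymmetric f}
  mul_mem' := by
    classical
    rintro f g ⟨⟨N, hN⟩, hf⟩ ⟨⟨N', hN'⟩, hg⟩
    refine ⟨⟨N + N', fun m hm => ?_⟩, ?_⟩
    · rw [coeff_mul] at hm
      obtain ⟨⟨p, q⟩, hp, h⟩ := Finset.exists_ne_zero_of_sum_ne_zero hm
      rw [← Finset.HasAntidiagonal.mem_antidiagonal.1 hp, map_add]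
      exact add_le_add (hN _ (left_ne_zero_of_mul h)) (hN' _ (right_ne_zero_of_mul h))
    · rw [isQuasiSymmetric_iff] at hf hg ⊢
      intro k i j
      rw [map_mul, map_mul, hf k i j, hg k i j]
  add_mem' := by
    rintro f g ⟨⟨N, hN⟩, hf⟩ ⟨⟨N', hN'⟩, hg⟩
    refine ⟨⟨max N N', fun m hm => ?_⟩, ?_⟩
    · by_contra! h
      refine hm ?_
      rw [map_add, not_imp_comm.1 (hN m) (by omega), not_imp_comm.1 (hN' m) (by omega), add_zero]
    · rw [isQuasiSymmetric_iff] at hf hg ⊢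
      intro k i j
      rw [map_add, map_add, hf k i j, hg k i j]
  algebraMap_mem' := by
    classical
    intro r
    refine ⟨⟨0, fun m hm => ?_⟩, ?_⟩
    · rw [MvPowerSeries.algebraMap_apply, coeff_C] at hm
      simp only [ne_eq, ite_eq_right_iff, Classical.not_imp] at hm
      simp [hm.1]
    · rw [isQuasiSymmetric_iff]
      intro k i j
      rw [AlgHom.commutes, AlgHom.commutes]

theorem coeff_eq_of_exps {f : MvPowerSeries ℕ ℂ} (hf : IsQuasiSymmetric f) {m m' : ℕ →₀ ℕ}
    (h : exps m = exps m') : coeff m f = coeff m' f := by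
  have key : ∀ m : ℕ →₀ ℕ, ∀ k : ℕ, ∀ hk : m.support.card = k, ∃ a : Fin k →₀ ℕ,
      a.embDomain (m.support.orderEmbOfFin hk).toEmbedding = m ∧
      ∀ i : Fin k, (exps m)[(i : ℕ)]? = some (a i) := by
    intro m k hk
    refine ⟨Finsupp.equivFunOnFinite.symm fun i => m (m.support.orderEmbOfFin hk i), ?_, ?_⟩
    · ext x
      by_cases hx : x ∈ m.support
      · have : x ∈ Set.range (m.support.orderEmbOfFin hk) := by
          rw [Finset.range_orderEmbOfFin]; exact hx
        obtain ⟨i, rfl⟩ := this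
        exact Finsupp.embDomain_apply_self (m.support.orderEmbOfFin hk).toEmbedding _ i
      · rw [Finsupp.embDomain_of_notMem_range, Finsupp.notMem_support_iff.1 hx]
        intro h
        have h' : x ∈ Set.range (m.support.orderEmbOfFin hk) := h
        rw [Finset.range_orderEmbOfFin] at h'
        exact hx h'
    · intro i
      have hi : (i : ℕ) < (exps m).length := by
        rw [exps, List.length_map, Finset.length_sort, hk]; exact i.2
      rw [List.getElem?_eq_getElem hi]
      simp [exps, Finset.orderEmbOfFin_apply]
  have hc : m'.support.card = m.support.card := by
    have := congrArg List.length h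
    simpa [exps] using this.symm
  obtain ⟨a, ha, ha'⟩ := key m _ rfl
  obtain ⟨b, hb, hb'⟩ := key m' _ hc
  have hab : a = b := by
    ext i
    have h1 := ha' i
    rw [h, hb' i] at h1
    exact (Option.some_injective _ h1).symm
  subst hab
  rw [← ha, ← hb]
  exact hf _ _ _ a

/-- The monomial quasisymmetric function `M_α = ∑_{i_1 < ⋯ < i_ℓ} x_{i_1}^{α_1} ⋯ x_{i_ℓ}^{α_ℓ}`, as
a power series: the coefficient of a monomial is `1` if its nonzero exponents, read in the order of
the variables, form `α`, and `0` otherwise. -/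
def monomialSeries (α : List ℕ+) : MvPowerSeries ℕ ℂ :=
  fun m => if exps m = α.map PNat.val then 1 else 0

theorem coeff_monomialSeries (α : List ℕ+) (m : ℕ →₀ ℕ) :
    coeff m (monomialSeries α) = if exps m = α.map PNat.val then 1 else 0 := rfl

/-- `M_α` as an element of `QSym`. -/
def M (α : List ℕ+) : QSym := ⟨monomialSeries α, by
  refine ⟨⟨(α.map PNat.val).sum, fun m hm => ?_⟩, fun k i j a => ?_⟩
  · rw [coeff_monomialSeries] at hm
    rw [← sum_exps, (ite_ne_right_iff.1 hm).1]
  · rw [coeff_monomialSeries, coeff_monomialSeries, exps_emb, exps_emb]⟩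

theorem coeff_M (α : List ℕ+) (m : ℕ →₀ ℕ) :
    coeff m (M α : MvPowerSeries ℕ ℂ) = if exps m = α.map PNat.val then 1 else 0 := rfl

/-- The size `|α|` of a composition. -/
def size (α : List ℕ+) : ℕ := (α.map PNat.val).sum

theorem degree_ofComp (α : List ℕ+) : (ofComp α).degree = size α := by
  rw [← sum_exps, exps_ofComp, size]

theorem finite_size_le (N : ℕ) : {α : List ℕ+ | size α ≤ N}.Finite := by
  induction N with
  | zero =>
    refine (Set.finite_singleton []).subset ?_
    intro α hα
    cases α with
    | nil => rfl
    | cons a α =>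
      have := a.pos
      simp only [size, List.map_cons, List.sum_cons, Set.mem_ofPred_eq] at hα
      omega
  | succ N ih =>
    refine (((Set.finite_singleton ([] : List ℕ+))).union
      ((Set.finite_Iic (⟨N + 1, N.succ_pos⟩ : ℕ+)).image2 List.cons ih)).subset ?_
    intro α hα
    cases α with
    | nil => exact Or.inl rfl
    | cons a α =>
      have := a.pos
      simp only [size, List.map_cons, List.sum_cons, Set.mem_ofPred_eq] at hα
      refine Or.inr ⟨a, ?_, α, ?_, rfl⟩
      · change (a : ℕ) ≤ N + 1
        omega
      · change (α.map PNat.val).sum ≤ N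
        omega

/-- The coefficients of a quasisymmetric function in the monomial basis. -/
def qcoeff : QSym →ₗ[ℂ] (List ℕ+ →₀ ℂ) where
  toFun f := Finsupp.ofSupportFinite (fun α => coeff (ofComp α) (f : MvPowerSeries ℕ ℂ)) (by
    obtain ⟨N, hN⟩ := f.2.1
    refine (finite_size_le N).subset fun α hα => ?_
    rw [Set.mem_ofPred_eq, ← degree_ofComp]
    exact hN _ hα)
  map_add' f g := by ext; simp [Finsupp.ofSupportFinite_coe]
  map_smul' c f := by ext; simp [Finsupp.ofSupportFinite_coe]

theorem qcoeff_apply (f : QSym) (α : List ℕ+) :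
    qcoeff f α = coeff (ofComp α) (f : MvPowerSeries ℕ ℂ) := rfl

theorem qcoeff_injective : Function.Injective qcoeff := by
  intro f g h
  apply Subtype.ext
  apply MvPowerSeries.ext
  intro m
  obtain ⟨α, hα⟩ := exists_comp m
  have h1 : exps m = exps (ofComp α) := by rw [exps_ofComp, hα]
  rw [coeff_eq_of_exps f.2.2 h1, coeff_eq_of_exps g.2.2 h1, ← qcoeff_apply, h, qcoeff_apply]

theorem qcoeff_M (α : List ℕ+) : qcoeff (M α) = Finsupp.single α 1 := by
  classical
  ext β
  rw [qcoeff_apply, coeff_M, exps_ofComp, Finsupp.single_apply]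
  simp only [map_coe_inj, eq_comm]

/-- The monomial basis of `QSym`. -/
def basisM : Module.Basis (List ℕ+) ℂ QSym :=
  .ofRepr (.ofBijective qcoeff ⟨qcoeff_injective, by
    intro c
    refine ⟨Finsupp.linearCombination ℂ M c, ?_⟩
    have : qcoeff ∘ₗ Finsupp.linearCombination ℂ M = LinearMap.id := by
      ext α : 2
      simp [qcoeff_M]
    exact congrArg (fun f => f c) this⟩)

theorem basisM_repr (f : QSym) (α : List ℕ+) :
    basisM.repr f α = coeff (ofComp α) (f : MvPowerSeries ℕ ℂ) := rfl

@[simp]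
theorem basisM_apply (α : List ℕ+) : basisM α = M α := by
  apply basisM.repr.injective
  rw [Module.Basis.repr_self]
  exact (qcoeff_M α).symm

theorem M_nil : M [] = 1 := by
  classical
  apply Subtype.ext
  apply MvPowerSeries.ext
  intro m
  rw [coeff_M, OneMemClass.coe_one, coeff_one]
  have : exps m = List.map PNat.val [] ↔ m = 0 := by
    constructor
    · intro h
      have h2 := congrArg List.length h
      simpa [exps] using h2
    · rintro rfl
      simp [exps]
  simp only [this]

/-- Concatenation of compositions and its finitely many factorizations. -/
def listFactorization : Factorization (List ℕ+) where
  op := (· ++ ·)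
  e := []
  op_assoc := List.append_assoc
  e_op := List.nil_append
  op_e := List.append_nil
  div α := (Finset.range (α.length + 1)).image fun i => (α.take i, α.drop i)
  mem_div := by
    rintro α ⟨β, γ⟩
    simp only [Finset.mem_image, Finset.mem_range, Prod.mk.injEq]
    constructor
    · rintro ⟨i, -, rfl, rfl⟩
      exact List.take_append_drop i α
    · rintro rfl
      exact ⟨β.length, by simp, by simp, by simp⟩

/-- The deconcatenation coproduct `Δ M_α = ∑_{βγ = α} M_β ⊗ M_γ`. -/
instance : Coalgebra ℂ QSym := basisCoalgebra basisM listFactorization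

theorem QSym.comul_M (α : List ℕ+) : Coalgebra.comul (R := ℂ) (M α) =
    ∑ i ∈ Finset.range (α.length + 1), M (α.take i) ⊗ₜ[ℂ] M (α.drop i) := by
  have h := basisComul_basis basisM listFactorization α
  rw [basisM_apply] at h
  change basisComul basisM listFactorization (M α) = _
  rw [h, listFactorization, Finset.sum_image]
  · simp only [basisM_apply]
  · intro i hi j hj h
    have h2 := congrArg List.length (Prod.ext_iff.1 h).1
    simp only [List.length_take] at h2
    simp only [Finset.coe_range, Set.mem_Iio] at hi hj
    omega

theorem QSym.counit_eq (f : QSym) :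
    Coalgebra.counit (R := ℂ) f = constantCoeff (f : MvPowerSeries ℕ ℂ) := by
  change basisM.repr f [] = _
  rw [basisM_repr, ← coeff_zero_eq_constantCoeff_apply]
  congr 1

/-- The monomial `x_0^{m_0} x_1^{m_1} ⋯` with all variables shifted by `N`. -/
def shift (N : ℕ) (m : ℕ →₀ ℕ) : ℕ →₀ ℕ := m.embDomain (addLeftEmbedding N)

theorem shift_apply_add (N : ℕ) (m : ℕ →₀ ℕ) (i : ℕ) : shift N m (N + i) = m i :=
  Finsupp.embDomain_apply_self (addLeftEmbedding N) m i

theorem shift_apply_lt {N i : ℕ} (m : ℕ →₀ ℕ) (h : i < N) : shift N m i = 0 := by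
  refine Finsupp.embDomain_of_notMem_range _ _ _ ?_
  rintro ⟨k, hk⟩
  simp at hk
  omega

theorem exps_add_shift {N : ℕ} {p : ℕ →₀ ℕ} (hp : ∀ i, N ≤ i → p i = 0) (r : ℕ →₀ ℕ) :
    exps (p + shift N r) = exps p ++ exps r := by
  have hr : exps r = (r.support.sort.map (N + ·)).map (p + shift N r) := by
    rw [exps, List.map_map]
    refine List.map_congr_left fun i _ => ?_
    simp [shift_apply_add, hp]
  have hq : exps p = p.support.sort.map (p + shift N r) := by
    refine List.map_congr_left fun i hi => ?_
    have hi' : i < N := by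
      by_contra! h
      exact Finsupp.mem_support_iff.1 ((Finset.mem_sort _).1 hi) (hp i h)
    simp [shift_apply_lt r hi']
  rw [hr, hq, ← List.map_append, exps]
  congr 1
  refine List.Perm.eq_of_pairwise (le := (· ≤ ·)) (fun a b _ _ h1 h2 => le_antisymm h1 h2)
    (Finset.pairwise_sort _ _) ?_ ?_
  · rw [List.pairwise_append]
    refine ⟨Finset.pairwise_sort _ _, ?_, ?_⟩
    · rw [List.pairwise_map]
      exact (Finset.pairwise_sort r.support (· ≤ ·)).imp (by intro a b h; omega)
    · intro a ha b hb
      obtain ⟨c, -, rfl⟩ := List.mem_map.1 hb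
      have : a < N := by
        by_contra! h
        exact Finsupp.mem_support_iff.1 ((Finset.mem_sort _).1 ha) (hp a h)
      omega
  · rw [List.perm_ext_iff_of_nodup (Finset.sort_nodup _ _)]
    · intro a
      simp only [Finset.mem_sort, Finsupp.mem_support_iff, Finsupp.add_apply, List.mem_append,
        List.mem_map]
      by_cases ha : a < N
      · rw [shift_apply_lt r ha]
        simp only [add_zero]
        constructor
        · exact Or.inl
        · rintro (h | ⟨c, -, rfl⟩)
          · exact h
          · omega
      · obtain ⟨c, rfl⟩ := Nat.exists_eq_add_of_le (not_lt.1 ha)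
        rw [shift_apply_add, hp _ (by omega)]
        simp
    · rw [List.nodup_append]
      refine ⟨Finset.sort_nodup _ _, (Finset.sort_nodup _ _).map (add_right_injective N), ?_⟩
      intro a ha b hb
      obtain ⟨c, -, rfl⟩ := List.mem_map.1 hb
      have : a < N := by
        by_contra! h
        exact Finsupp.mem_support_iff.1 ((Finset.mem_sort _).1 ha) (hp a h)
      omega

theorem coeff_mul_shift {N : ℕ} {p : ℕ →₀ ℕ} (hp : ∀ i, N ≤ i → p i = 0) (r : ℕ →₀ ℕ)
    (f g : MvPowerSeries ℕ ℂ) :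
    coeff (p + shift N r) (f * g) = ∑ x ∈ Finset.HasAntidiagonal.antidiagonal p, ∑ y ∈ Finset.HasAntidiagonal.antidiagonal r,
      coeff (x.1 + shift N y.1) f * coeff (x.2 + shift N y.2) g := by
  classical
  rw [coeff_mul, ← Finset.sum_product']
  symm
  have low : ∀ x : ℕ →₀ ℕ, ∀ y, (∀ i, N ≤ i → x i = 0) →
      (x + shift N y).filter (· < N) = x := by
    intro x y hx
    ext i
    rw [Finsupp.filter_apply]
    split_ifs with h
    · simp [shift_apply_lt y h]
    · exact (hx i (by omega)).symm
  have high : ∀ x : ℕ →₀ ℕ, ∀ y, (∀ i, N ≤ i → x i = 0) →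
      (x + shift N y).comapDomain (N + ·) (add_right_injective N).injOn = y := by
    intro x y hx
    ext i
    simp [Finsupp.comapDomain_apply, shift_apply_add, hx]
  have split : ∀ z : ℕ →₀ ℕ, z.filter (· < N) +
      shift N (z.comapDomain (N + ·) (add_right_injective N).injOn) = z := by
    intro z
    ext i
    rw [Finsupp.add_apply, Finsupp.filter_apply]
    by_cases h : i < N
    · simp [h, shift_apply_lt _ h]
    · obtain ⟨c, rfl⟩ := Nat.exists_eq_add_of_le (not_lt.1 h)
      simp [shift_apply_add, Finsupp.comapDomain_apply]
  have shift_add : ∀ a b : ℕ →₀ ℕ, shift N (a + b) = shift N a + shift N b := by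
    intro a b
    simp only [shift, Finsupp.embDomain_eq_mapDomain, Finsupp.mapDomain_add]
  have sub : ∀ x ∈ Finset.HasAntidiagonal.antidiagonal p, (∀ i, N ≤ i → x.1 i = 0) ∧ ∀ i, N ≤ i → x.2 i = 0 := by
    intro x hx
    rw [Finset.HasAntidiagonal.mem_antidiagonal] at hx
    refine ⟨fun i hi => ?_, fun i hi => ?_⟩ <;>
    · have h := hp i hi
      rw [← hx, Finsupp.add_apply] at h
      omega
  refine Finset.sum_bij' (fun z _ => (z.1.1 + shift N z.2.1, z.1.2 + shift N z.2.2))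
    (fun z _ => ((z.1.filter (· < N), z.2.filter (· < N)),
      (z.1.comapDomain (N + ·) (add_right_injective N).injOn,
        z.2.comapDomain (N + ·) (add_right_injective N).injOn))) ?_ ?_ ?_ ?_ ?_
  · rintro ⟨⟨a, b⟩, c, d⟩ h
    simp only [Finset.mem_product, Finset.HasAntidiagonal.mem_antidiagonal] at h ⊢
    rw [← h.1, ← h.2, shift_add]
    abel
  · rintro ⟨z, z'⟩ h
    simp only [Finset.mem_product, Finset.HasAntidiagonal.mem_antidiagonal] at h ⊢
    constructor
    · rw [← Finsupp.filter_add, h, low p r hp]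
    · have h3 := high p r hp
      rw [← h] at h3
      rw [← h3]
      ext i
      simp [Finsupp.comapDomain_apply]
  · rintro ⟨⟨a, b⟩, c, d⟩ h
    simp only [Finset.mem_product] at h
    obtain ⟨h1, h2⟩ := sub _ h.1
    simp only [low a c h1, low b d h2, high a c h1, high b d h2]
  · rintro ⟨z, z'⟩ h
    simp only [split]
  · rintro ⟨⟨a, b⟩, c, d⟩ h
    rfl

/-- The coefficient of `x^p y^r` in an element of `QSym ⊗ QSym`. -/
def coeff₂ (p r : ℕ →₀ ℕ) : QSym ⊗[ℂ] QSym →ₗ[ℂ] ℂ :=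
  LinearMap.mul' ℂ ℂ ∘ₗ TensorProduct.map (coeff p ∘ₗ QSym.val.toLinearMap)
    (coeff r ∘ₗ QSym.val.toLinearMap)

@[simp]
theorem coeff₂_tmul (p r : ℕ →₀ ℕ) (f g : QSym) : coeff₂ p r (f ⊗ₜ g) =
    coeff p (f : MvPowerSeries ℕ ℂ) * coeff r (g : MvPowerSeries ℕ ℂ) := rfl

theorem coeff₂_mul (p r : ℕ →₀ ℕ) (s t : QSym ⊗[ℂ] QSym) :
    coeff₂ p r (s * t) = ∑ x ∈ Finset.HasAntidiagonal.antidiagonal p, ∑ y ∈ Finset.HasAntidiagonal.antidiagonal r,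
      coeff₂ x.1 y.1 s * coeff₂ x.2 y.2 t := by
  classical
  induction s with
  | zero => simp
  | add s s' h h' => simp only [add_mul, map_add, h, h', Finset.sum_add_distrib]
  | tmul a b =>
    induction t with
    | zero => simp
    | add s s' h h' => simp only [mul_add, map_add, h, h', Finset.sum_add_distrib]
    | tmul c d =>
      rw [Algebra.TensorProduct.tmul_mul_tmul, coeff₂_tmul, MulMemClass.coe_mul,
        MulMemClass.coe_mul, coeff_mul, coeff_mul, Finset.sum_mul_sum]
      refine Finset.sum_congr rfl fun x _ => Finset.sum_congr rfl fun y _ => ?_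
      rw [coeff₂_tmul, coeff₂_tmul]
      ring

theorem coeff₂_ofComp (α β : List ℕ+) (t : QSym ⊗[ℂ] QSym) :
    coeff₂ (ofComp α) (ofComp β) t = (basisM.tensorProduct basisM).repr t (α, β) := by
  induction t with
  | zero => simp
  | add x y hx hy => simp only [map_add, Finsupp.add_apply, hx, hy]
  | tmul x y =>
    rw [coeff₂_tmul, Module.Basis.tensorProduct_repr_tmul_apply, basisM_repr, basisM_repr,
      smul_eq_mul, mul_comm]

theorem coeff₂_congr {p r p' r' : ℕ →₀ ℕ} (h : exps p = exps p') (h' : exps r = exps r')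
    (t : QSym ⊗[ℂ] QSym) : coeff₂ p r t = coeff₂ p' r' t := by
  induction t with
  | zero => simp
  | add x y hx hy => simp only [map_add, hx, hy]
  | tmul x y =>
    rw [coeff₂_tmul, coeff₂_tmul, coeff_eq_of_exps x.2.2 h, coeff_eq_of_exps y.2.2 h']

theorem coeff₂_comul {N : ℕ} {p : ℕ →₀ ℕ} (hp : ∀ i, N ≤ i → p i = 0) (r : ℕ →₀ ℕ) (f : QSym) :
    coeff₂ p r (Coalgebra.comul (R := ℂ) f) =
      coeff (p + shift N r) (f : MvPowerSeries ℕ ℂ) := by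
  obtain ⟨α, hα⟩ := exists_comp p
  obtain ⟨β, hβ⟩ := exists_comp r
  rw [coeff₂_congr (p' := ofComp α) (r' := ofComp β) (by rw [exps_ofComp, hα])
    (by rw [exps_ofComp, hβ]), coeff₂_ofComp]
  change (basisM.tensorProduct basisM).repr (basisComul basisM listFactorization f) _ = _
  rw [basisComul_repr, basisM_repr]
  refine coeff_eq_of_exps f.2.2 ?_
  rw [exps_add_shift hp, exps_ofComp, ← hα, ← hβ]
  exact List.map_append

/-- `QSym` is a bialgebra. -/
instance : Bialgebra ℂ QSym :=
  Bialgebra.mk' ℂ QSym (by rw [QSym.counit_eq]; simp)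
    (by intro a b; simp [QSym.counit_eq])
    (by
      have h := QSym.comul_M []
      rw [M_nil] at h
      rw [h]
      simp [M_nil, Algebra.TensorProduct.one_def])
    (by
      intro a b
      refine (basisM.tensorProduct basisM).ext_elem ?_
      rintro ⟨α, β⟩
      have hN : ∀ i, α.length ≤ i → ofComp α i = 0 := by
        intro i hi
        rw [← Finsupp.notMem_support_iff, ofComp_support]
        simpa using hi
      rw [← coeff₂_ofComp, ← coeff₂_ofComp, coeff₂_mul, coeff₂_comul hN, MulMemClass.coe_mul,
        coeff_mul_shift hN]
      refine Finset.sum_congr rfl fun x hx => Finset.sum_congr rfl fun y hy => ?_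
      rw [Finset.HasAntidiagonal.mem_antidiagonal] at hx
      rw [coeff₂_comul (N := α.length), coeff₂_comul (N := α.length)] <;>
      · intro i hi
        have h := hN i hi
        rw [← hx, Finsupp.add_apply] at h
        omega)

/-- The degree `n` part of `QSym`, spanned by the `M_α` with `α ⊨ n`. -/
def QSym.grading (n : ℕ) : Submodule ℂ QSym :=
  Submodule.span ℂ {x | ∃ α : List ℕ+, size α = n ∧ M α = x}

theorem QSym.grading_eq : QSym.grading = weightSpan basisM size := by
  funext n
  simp [QSym.grading, weightSpan]

theorem size_append (α β : List ℕ+) : size (α ++ β) = size α + size β := by simp [size]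

theorem size_eq_zero {α : List ℕ+} : size α = 0 ↔ α = [] := by
  cases α with
  | nil => simp [size]
  | cons a α => simp [size]

theorem QSym.mem_grading {n : ℕ} {f : QSym} :
    f ∈ QSym.grading n ↔ ∀ m, coeff m (f : MvPowerSeries ℕ ℂ) ≠ 0 → m.degree = n := by
  rw [QSym.grading_eq, mem_weightSpan]
  constructor
  · intro h m hm
    obtain ⟨α, hα⟩ := exists_comp m
    have h1 : exps m = exps (ofComp α) := by rw [exps_ofComp, hα]
    rw [coeff_eq_of_exps f.2.2 h1] at hm
    rw [← sum_exps, h1, sum_exps, degree_ofComp]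
    exact h α hm
  · intro h α hα
    rw [← degree_ofComp]
    exact h _ hα

instance : SetLike.GradedMonoid QSym.grading where
  one_mem := by
    rw [← M_nil]
    exact Submodule.subset_span ⟨[], rfl, rfl⟩
  mul_mem := by
    classical
    intro i j f g hf hg
    rw [QSym.mem_grading] at hf hg ⊢
    intro m hm
    rw [MulMemClass.coe_mul, coeff_mul] at hm
    obtain ⟨⟨p, q⟩, hp, h⟩ := Finset.exists_ne_zero_of_sum_ne_zero hm
    rw [← Finset.HasAntidiagonal.mem_antidiagonal.1 hp, map_add, hf _ (left_ne_zero_of_mul h),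
      hg _ (right_ne_zero_of_mul h)]

instance : DirectSum.Decomposition QSym.grading :=
  QSym.grading_eq ▸ weightDecomposition basisM size

instance : GradedAlgebra QSym.grading where

instance : ConnectedGraded QSym.grading where
  connected := by
    rw [QSym.grading_eq]
    exact weightSpan_zero basisM size (k₀ := []) (by simp [M_nil]) fun _ => size_eq_zero
  comul_mem := by
    intro n x hx
    induction hx using Submodule.span_induction with
    | mem x hx =>
      obtain ⟨α, rfl, rfl⟩ := hx
      rw [QSym.comul_M]
      refine Submodule.sum_mem _ fun i _ => ?_
      refine tmul_mem_tensorDegree (i := size (α.take i)) (j := size (α.drop i)) ?_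
        (Submodule.subset_span ⟨_, rfl, rfl⟩) (Submodule.subset_span ⟨_, rfl, rfl⟩)
      rw [← size_append, List.take_append_drop]
    | zero => simp
    | add x y _ _ hx hy => rw [map_add]; exact Submodule.add_mem _ hx hy
    | smul c x _ hx => rw [map_smul]; exact Submodule.smul_mem _ c hx
  counit_eq := by
    intro n hn x hx
    rw [QSym.counit_eq, ← coeff_zero_eq_constantCoeff_apply]
    by_contra h
    exact hn ((QSym.mem_grading.1 hx 0 h).symm.trans (by simp))

instance : HopfAlgebra ℂ QSym := hopfOfConnected QSym.grading

end QuasiSymmetric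

section Symmetric

open MvPowerSeries

/-- The algebra `Sym` of symmetric functions: the quasisymmetric functions that are invariant under
all permutations of the variables. -/
def Sym : Subalgebra ℂ (MvPowerSeries ℕ ℂ) where
  carrier := {f | f ∈ QSym ∧ ∀ (σ : Equiv.Perm ℕ) (m : ℕ →₀ ℕ),
    coeff (m.embDomain σ.toEmbedding) f = coeff m f}
  mul_mem' := by
    rintro f g ⟨hfQ, hf⟩ ⟨hgQ, hg⟩
    refine ⟨mul_mem hfQ hgQ, fun σ m => ?_⟩
    have hf' : killCompl σ.toEmbedding f = f := MvPowerSeries.ext fun m => hf σ m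
    have hg' : killCompl σ.toEmbedding g = g := MvPowerSeries.ext fun m => hg σ m
    rw [← coeff_killCompl, map_mul, hf', hg']
  add_mem' := by
    rintro f g ⟨hfQ, hf⟩ ⟨hgQ, hg⟩
    refine ⟨add_mem hfQ hgQ, fun σ m => ?_⟩
    rw [map_add, map_add, hf σ m, hg σ m]
  algebraMap_mem' := by
    intro r
    refine ⟨algebraMap_mem QSym r, fun σ m => ?_⟩
    rw [← coeff_killCompl, AlgHom.commutes]

/-- The inclusion of `Sym` in `QSym`. -/
def Sym.incl : Sym →ₐ[ℂ] QSym := Subalgebra.inclusion fun _ hf => hf.1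

theorem Sym.coe_incl (f : Sym) : (Sym.incl f : MvPowerSeries ℕ ℂ) = f := rfl

theorem Sym.incl_injective : Function.Injective Sym.incl := Subalgebra.inclusion_injective _

theorem exists_perm {l l' : List ℕ} (h : l.Perm l') :
    ∃ σ : Equiv.Perm ℕ, ∀ i, l'.getD (σ i) 0 = l.getD i 0 := by
  induction h with
  | nil => exact ⟨1, fun i => rfl⟩
  | @cons x l l' _ ih =>
    obtain ⟨σ, hσ⟩ := ih
    refine ⟨⟨fun i => Nat.casesOn i 0 fun n => σ n + 1,
      fun i => Nat.casesOn i 0 fun n => σ.symm n + 1, ?_, ?_⟩, ?_⟩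
    · rintro (_ | n) <;> simp
    · rintro (_ | n) <;> simp
    · rintro (_ | n)
      · simp
      · simpa using hσ n
  | swap x y l =>
    refine ⟨Equiv.swap 0 1, ?_⟩
    rintro (_ | _ | n)
    · simp
    · simp
    · rw [Equiv.swap_apply_of_ne_of_ne (by omega) (by omega)]
      simp
  | trans _ _ h1 h2 =>
    obtain ⟨σ, hσ⟩ := h1
    obtain ⟨τ, hτ⟩ := h2
    exact ⟨σ.trans τ, fun i => by rw [Equiv.trans_apply, hτ, hσ]⟩

theorem Sym.coeff_ofComp (f : Sym) {α β : List ℕ+} (h : α.Perm β) :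
    coeff (ofComp α) (f : MvPowerSeries ℕ ℂ) = coeff (ofComp β) (f : MvPowerSeries ℕ ℂ) := by
  obtain ⟨σ, hσ⟩ := exists_perm (h.map PNat.val)
  rw [← f.2.2 σ]
  suffices h : (ofComp α).embDomain σ.toEmbedding = ofComp β by rw [h]
  ext i
  obtain ⟨j, rfl⟩ := Equiv.surjective σ i
  refine (Finsupp.embDomain_apply_self σ.toEmbedding _ j).trans ?_
  simp only [ofComp, List.toFinsupp_apply, hσ]

/-- The monomial symmetric function `m_λ`, the sum of the `M_α` over the distinct rearrangements
`α` of the partition `λ`, where `λ` is given as a multiset of positive integers. -/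
def msymQ (s : Multiset ℕ+) : QSym := by
  classical exact ∑ α ∈ s.lists.toFinset, M α

theorem coeff_msymQ (s : Multiset ℕ+) (m : ℕ →₀ ℕ) :
    coeff m (msymQ s : MvPowerSeries ℕ ℂ) =
      if (exps m : Multiset ℕ) = s.map PNat.val then 1 else 0 := by
  classical
  obtain ⟨β, hβ⟩ := exists_comp m
  have h1 : (msymQ s : MvPowerSeries ℕ ℂ) =
      ∑ α ∈ s.lists.toFinset, (M α : MvPowerSeries ℕ ℂ) := by
    rw [msymQ]
    exact map_sum QSym.val _ _
  rw [h1, map_sum]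
  simp only [coeff_M, ← hβ, map_coe_inj]
  rw [Finset.sum_ite_eq]
  simp only [Multiset.mem_toFinset, Multiset.mem_lists_iff, Multiset.quot_mk_to_coe,
    ← Multiset.map_coe, (Multiset.map_injective PNat.coe_injective).eq_iff, eq_comm]

theorem msymQ_mem (s : Multiset ℕ+) : (msymQ s : MvPowerSeries ℕ ℂ) ∈ Sym := by
  refine ⟨(msymQ s).2, fun σ m => ?_⟩
  rw [coeff_msymQ, coeff_msymQ, coe_exps, coe_exps]
  have : (m.embDomain σ.toEmbedding).support.val.map (m.embDomain σ.toEmbedding) =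
      m.support.val.map m := by
    rw [Finsupp.support_embDomain, Finset.map_val, Multiset.map_map]
    refine Multiset.map_congr rfl fun i _ => ?_
    exact Finsupp.embDomain_apply_self σ.toEmbedding m i
  rw [this]

/-- `m_λ` as an element of `Sym`. -/
def msym (s : Multiset ℕ+) : Sym := ⟨msymQ s, msymQ_mem s⟩

theorem incl_msym (s : Multiset ℕ+) : Sym.incl (msym s) = msymQ s := rfl

/-- The coefficients of a symmetric function in the monomial basis. -/
def scoeff : Sym →ₗ[ℂ] (Multiset ℕ+ →₀ ℂ) :=
  Finsupp.lcomapDomain Multiset.toList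
    (fun s t h => by rw [← Multiset.coe_toList s, h, Multiset.coe_toList]) ∘ₗ
    qcoeff ∘ₗ Sym.incl.toLinearMap

theorem scoeff_apply (f : Sym) (s : Multiset ℕ+) :
    scoeff f s = coeff (ofComp s.toList) (f : MvPowerSeries ℕ ℂ) := rfl

theorem scoeff_coe (f : Sym) (α : List ℕ+) :
    scoeff f α = coeff (ofComp α) (f : MvPowerSeries ℕ ℂ) := by
  rw [scoeff_apply]
  refine Sym.coeff_ofComp f ?_
  rw [← Multiset.coe_eq_coe, Multiset.coe_toList]

theorem scoeff_injective : Function.Injective scoeff := by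
  intro f g h
  apply Sym.incl_injective
  apply qcoeff_injective
  ext α
  rw [qcoeff_apply, qcoeff_apply, Sym.coe_incl, Sym.coe_incl, ← scoeff_coe, ← scoeff_coe, h]

theorem scoeff_msym (s : Multiset ℕ+) : scoeff (msym s) = Finsupp.single s 1 := by
  classical
  ext t
  rw [scoeff_apply, ← Sym.coe_incl, incl_msym, coeff_msymQ, exps_ofComp, ← Multiset.map_coe, Multiset.coe_toList,
    Finsupp.single_apply]
  simp only [(Multiset.map_injective PNat.coe_injective).eq_iff, eq_comm]

/-- The monomial basis of `Sym`. -/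
def basisSym : Module.Basis (Multiset ℕ+) ℂ Sym :=
  .ofRepr (.ofBijective scoeff ⟨scoeff_injective, by
    intro c
    refine ⟨Finsupp.linearCombination ℂ msym c, ?_⟩
    have : scoeff ∘ₗ Finsupp.linearCombination ℂ msym = LinearMap.id := by
      ext α : 2
      simp [scoeff_msym]
    exact congrArg (fun f => f c) this⟩)

theorem basisSym_repr_coe (f : Sym) (α : List ℕ+) :
    basisSym.repr f α = basisM.repr (Sym.incl f) α := scoeff_coe f α

@[simp]
theorem basisSym_apply (s : Multiset ℕ+) : basisSym s = msym s := by
  apply basisSym.repr.injective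
  rw [Module.Basis.repr_self]
  exact (scoeff_msym s).symm

/-- Union of multisets and its finitely many factorizations. -/
def multisetFactorization : Factorization (Multiset ℕ+) where
  op := (· + ·)
  e := 0
  op_assoc := add_assoc
  e_op := zero_add
  op_e := add_zero
  div s := s.antidiagonal.toFinset
  mem_div := by simp

/-- The coproduct `Δ m_λ = ∑_{μ ∪ ν = λ} m_μ ⊗ m_ν`; it is the restriction of the coproduct of
`QSym`, see `Sym.comul_incl`. -/
instance : Coalgebra ℂ Sym := basisCoalgebra basisSym multisetFactorization

theorem basisSym_tensor (t : Sym ⊗[ℂ] Sym) (α β : List ℕ+) :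
    (basisM.tensorProduct basisM).repr
        (TensorProduct.map Sym.incl.toLinearMap Sym.incl.toLinearMap t) (α, β) =
      (basisSym.tensorProduct basisSym).repr t ((α : Multiset ℕ+), (β : Multiset ℕ+)) := by
  induction t with
  | zero => simp
  | add x y hx hy => simp only [map_add, Finsupp.add_apply, hx, hy]
  | tmul x y =>
    rw [TensorProduct.map_tmul, Module.Basis.tensorProduct_repr_tmul_apply,
      Module.Basis.tensorProduct_repr_tmul_apply, basisSym_repr_coe, basisSym_repr_coe]
    rfl

theorem Sym.map_incl_injective : Function.Injective
    (TensorProduct.map Sym.incl.toLinearMap Sym.incl.toLinearMap) :=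
  TensorProduct.map_injective_of_flat_flat _ _ Sym.incl_injective Sym.incl_injective

theorem Sym.comul_incl (f : Sym) :
    TensorProduct.map Sym.incl.toLinearMap Sym.incl.toLinearMap (Coalgebra.comul (R := ℂ) f) =
      Coalgebra.comul (R := ℂ) (Sym.incl f) := by
  refine (basisM.tensorProduct basisM).ext_elem ?_
  rintro ⟨α, β⟩
  rw [basisSym_tensor]
  change (basisSym.tensorProduct basisSym).repr (basisComul basisSym multisetFactorization f) _ =
    (basisM.tensorProduct basisM).repr (basisComul basisM listFactorization (Sym.incl f)) _
  rw [basisComul_repr, basisComul_repr]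
  exact basisSym_repr_coe f (α ++ β)

theorem Sym.counit_incl (f : Sym) :
    Coalgebra.counit (R := ℂ) f = Coalgebra.counit (R := ℂ) (Sym.incl f) :=
  basisSym_repr_coe f []

/-- `Sym` is a bialgebra. -/
instance : Bialgebra ℂ Sym :=
  Bialgebra.mk' ℂ Sym
    (by rw [Sym.counit_incl, map_one, Bialgebra.counit_one])
    (by
      intro a b
      rw [Sym.counit_incl, Sym.counit_incl, Sym.counit_incl, map_mul,
        Bialgebra.counit_mul])
    (by
      apply Sym.map_incl_injective
      rw [Sym.comul_incl, map_one, Bialgebra.comul_one]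
      exact (map_one (Algebra.TensorProduct.map Sym.incl Sym.incl)).symm)
    (by
      intro a b
      apply Sym.map_incl_injective
      rw [Sym.comul_incl, map_mul, Bialgebra.comul_mul, ← Sym.comul_incl,
        ← Sym.comul_incl]
      exact (map_mul (Algebra.TensorProduct.map Sym.incl Sym.incl) _ _).symm)

/-- The degree `n` part of `Sym`. -/
def Sym.grading (n : ℕ) : Submodule ℂ Sym :=
  (QSym.grading n).comap Sym.incl.toLinearMap

/-- The size `|λ|` of a partition. -/
def msize (s : Multiset ℕ+) : ℕ := (s.map PNat.val).sum

theorem msize_coe (α : List ℕ+) : msize α = size α := by simp [msize, size]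

theorem Sym.grading_eq : Sym.grading = weightSpan basisSym msize := by
  funext n
  ext f
  rw [mem_weightSpan, Sym.grading, Submodule.mem_comap, QSym.grading_eq, mem_weightSpan]
  constructor
  · intro h s hs
    obtain ⟨α, rfl⟩ := Quotient.exists_rep s
    rw [Multiset.quot_mk_to_coe] at hs ⊢
    rw [basisSym_repr_coe] at hs
    rw [msize_coe]
    exact h α hs
  · intro h α hα
    rw [← msize_coe]
    refine h α ?_
    rw [basisSym_repr_coe]
    exact hα

instance : SetLike.GradedMonoid Sym.grading where
  one_mem := by
    rw [Sym.grading, Submodule.mem_comap, AlgHom.toLinearMap_apply, map_one]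
    exact SetLike.GradedOne.one_mem (A := QSym.grading)
  mul_mem := by
    intro i j f g hf hg
    rw [Sym.grading, Submodule.mem_comap, AlgHom.toLinearMap_apply] at *
    rw [map_mul]
    exact SetLike.mul_mem_graded (A := QSym.grading) hf hg

instance : DirectSum.Decomposition Sym.grading :=
  Sym.grading_eq ▸ weightDecomposition basisSym msize

instance : GradedAlgebra Sym.grading where

theorem msym_zero : msym 0 = 1 := by
  apply Sym.incl_injective
  rw [incl_msym, map_one]
  have : (0 : Multiset ℕ+) = (([] : List ℕ+) : Multiset ℕ+) := rfl
  rw [msymQ, this, Multiset.lists_coe]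
  simp [M_nil]

instance : ConnectedGraded Sym.grading where
  connected := by
    rw [Sym.grading_eq]
    refine weightSpan_zero basisSym msize (k₀ := 0) (by simp [msym_zero]) fun s => ?_
    obtain ⟨α, rfl⟩ := Quotient.exists_rep s
    rw [Multiset.quot_mk_to_coe, msize_coe, size_eq_zero, Multiset.coe_eq_zero]
  comul_mem := by
    intro n x hx
    rw [Sym.grading_eq] at hx ⊢
    induction hx using Submodule.span_induction with
    | mem x hx =>
      obtain ⟨s, rfl, rfl⟩ := hx
      change basisComul basisSym multisetFactorization _ ∈ _
      rw [basisComul_basis]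
      refine Submodule.sum_mem _ fun p hp => ?_
      refine tmul_mem_tensorDegree (i := msize p.1) (j := msize p.2) ?_
        (basis_mem_weightSpan _ _ _) (basis_mem_weightSpan _ _ _)
      rw [multisetFactorization.mem_div] at hp
      rw [← hp]
      simp [msize, multisetFactorization]
    | zero => simp
    | add x y _ _ hx hy => rw [map_add]; exact Submodule.add_mem _ hx hy
    | smul c x _ hx => rw [map_smul]; exact Submodule.smul_mem _ c hx
  counit_eq := by
    intro n hn x hx
    rw [Sym.counit_incl]
    exact ConnectedGraded.counit_eq (𝒜 := QSym.grading) n hn _ hx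

instance : HopfAlgebra ℂ Sym := hopfOfConnected Sym.grading

theorem msymQ_singleton (n : ℕ+) : msymQ {n} = M [n] := by
  have : ({n} : Multiset ℕ+) = (([n] : List ℕ+) : Multiset ℕ+) := rfl
  rw [msymQ, this, Multiset.lists_coe]
  have h : ([n].permutations : Multiset (List ℕ+)).toFinset = {[n]} := by
    ext l
    simp
  rw [h, Finset.sum_singleton]

/-- The scaled power sum function `p_n = (1/n) M_{(n)}`. -/
def p (n : ℕ+) : Sym :=
  ⟨((n : ℕ) : ℂ)⁻¹ • (M [n] : MvPowerSeries ℕ ℂ),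
    Sym.smul_mem (by rw [← msymQ_singleton]; exact msymQ_mem _) _⟩

end Symmetric

section Characters

open MvPowerSeries

/-- Setting `x_1 = x_2 = ⋯ = 0`, as a power series in `x_0`. -/
def restrictX : QSym →ₐ[ℂ] PowerSeries ℂ :=
  (killCompl (⟨fun _ => 0, fun _ _ _ => rfl⟩ : Unit ↪ ℕ)).comp QSym.val

theorem coeff_restrictX (f : QSym) (k : ℕ) :
    PowerSeries.coeff k (restrictX f) = coeff (Finsupp.single 0 k) (f : MvPowerSeries ℕ ℂ) := by
  rw [PowerSeries.coeff]
  change coeff (Finsupp.embDomain _ (Finsupp.single () k)) (f : MvPowerSeries ℕ ℂ) = _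
  rw [Finsupp.embDomain_single]
  rfl

theorem exists_polynomial (f : QSym) : ∃ q : Polynomial ℂ, (q : PowerSeries ℂ) = restrictX f := by
  obtain ⟨N, hN⟩ := f.2.1
  refine ⟨PowerSeries.trunc (N + 1) (restrictX f), ?_⟩
  ext k
  rw [Polynomial.coeff_coe, PowerSeries.coeff_trunc]
  split_ifs with h
  · rfl
  · rw [coeff_restrictX]
    by_contra h0
    have := hN _ (Ne.symm h0)
    rw [Finsupp.degree_single] at this
    omega

theorem finsum_eq_eval {f : QSym} {q : Polynomial ℂ} (h : (q : PowerSeries ℂ) = restrictX f) :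
    ∑ᶠ k, coeff (Finsupp.single 0 k) (f : MvPowerSeries ℕ ℂ) = q.eval 1 := by
  have : ∀ k, coeff (Finsupp.single 0 k) (f : MvPowerSeries ℕ ℂ) = q.coeff k := by
    intro k
    rw [← coeff_restrictX, ← h, Polynomial.coeff_coe]
  simp only [this, Polynomial.eval_eq_sum, Polynomial.sum, one_pow, mul_one]
  refine finsum_eq_sum_of_support_subset _ fun k hk => ?_
  exact Polynomial.mem_support_iff.2 hk

/-- The character `f ↦ f(1, 0, 0, …)` of `QSym`: the (finite) sum of the coefficients of the
powers of `x_0`. -/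
def zetaQSym : QSym →ₐ[ℂ] ℂ :=
  AlgHom.ofLinearMap
    { toFun f := ∑ᶠ k, coeff (Finsupp.single 0 k) (f : MvPowerSeries ℕ ℂ)
      map_add' f g := by
        obtain ⟨q, hq⟩ := exists_polynomial f
        obtain ⟨r, hr⟩ := exists_polynomial g
        rw [finsum_eq_eval hq, finsum_eq_eval hr, finsum_eq_eval (q := q + r), Polynomial.eval_add]
        rw [Polynomial.coe_add, hq, hr, map_add]
      map_smul' c f := by
        obtain ⟨q, hq⟩ := exists_polynomial f
        rw [finsum_eq_eval hq, finsum_eq_eval (q := c • q), Polynomial.eval_smul]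
        · rfl
        · rw [Polynomial.coe_smul, hq, map_smul] }
    (by
      change ∑ᶠ k, coeff (Finsupp.single 0 k) ((1 : QSym) : MvPowerSeries ℕ ℂ) = 1
      rw [finsum_eq_eval (q := 1), Polynomial.eval_one]
      rw [Polynomial.coe_one, map_one])
    (by
      intro f g
      change ∑ᶠ k, coeff (Finsupp.single 0 k) ((f * g : QSym) : MvPowerSeries ℕ ℂ) =
        (∑ᶠ k, coeff (Finsupp.single 0 k) (f : MvPowerSeries ℕ ℂ)) *
        ∑ᶠ k, coeff (Finsupp.single 0 k) (g : MvPowerSeries ℕ ℂ)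
      obtain ⟨q, hq⟩ := exists_polynomial f
      obtain ⟨r, hr⟩ := exists_polynomial g
      rw [finsum_eq_eval hq, finsum_eq_eval hr, finsum_eq_eval (q := q * r), Polynomial.eval_mul]
      rw [Polynomial.coe_mul, hq, hr, map_mul])

/-- The restriction of `zetaQSym` to `Sym`. -/
def zetaSym : Sym →ₐ[ℂ] ℂ := zetaQSym.comp Sym.incl

variable {H : Type*} [CommRing H] [HopfAlgebra ℂ H]

/-- The algebra automorphism that multiplies every element of degree `n` by `(-1)ⁿ`. -/
def degreeSign (𝒜 : ℕ → Submodule ℂ H) [GradedAlgebra 𝒜] : H →ₐ[ℂ] H :=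
  (DirectSum.toAlgebra ℂ (fun n => 𝒜 n) (fun n => ((-1 : ℂ) ^ n) • (𝒜 n).subtype)
    (by
      simp only [pow_zero, one_smul]
      rfl)
    (by
      intro i j a b
      simp only [LinearMap.smul_apply, Submodule.subtype_apply, SetLike.coe_gMul, pow_add,
        smul_mul_smul_comm])).comp
  (DirectSum.decomposeAlgEquiv 𝒜).toAlgHom

theorem degreeSign_apply (𝒜 : ℕ → Submodule ℂ H) [GradedAlgebra 𝒜] {n : ℕ} {x : H}
    (hx : x ∈ 𝒜 n) : degreeSign 𝒜 x = (-1 : ℂ) ^ n • x := by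
  lift x to 𝒜 n using hx
  simp only [degreeSign, AlgHom.comp_apply]
  have h : (DirectSum.decomposeAlgEquiv 𝒜).toAlgHom (x : H) = DirectSum.of (fun i => 𝒜 i) n x :=
    DirectSum.decompose_coe 𝒜 x
  rw [h]
  exact DirectSum.toAddMonoid_of (β := fun i => 𝒜 i)
    (fun i => (((-1 : ℂ) ^ i) • (𝒜 i).subtype).toAddMonoidHom) n x

/-- The character `\bar ζ`, with `\bar ζ = (-1)ⁿ ζ` on elements of degree `n`. -/
def barChar (𝒜 : ℕ → Submodule ℂ H) [GradedAlgebra 𝒜] (ζ : H →ₐ[ℂ] ℂ) : H →ₐ[ℂ] ℂ :=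
  ζ.comp (degreeSign 𝒜)

/-- The convolution inverse `ζ ∘ S` of a character. -/
def invChar (ζ : H →ₐ[ℂ] ℂ) : H →ₐ[ℂ] ℂ := ζ.comp (HopfAlgebra.antipodeAlgHom ℂ H)

/-- The convolution product `m ∘ (ζ ⊗ ζ') ∘ Δ` of two characters. -/
def convChar (ζ ζ' : H →ₐ[ℂ] ℂ) : H →ₐ[ℂ] ℂ :=
  (Algebra.TensorProduct.lmul' ℂ).comp
    ((Algebra.TensorProduct.map ζ ζ').comp (Bialgebra.comulAlgHom ℂ H))

/-- The character `\overline{ζ^{-1}} ζ`. -/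
def thetaChar (𝒜 : ℕ → Submodule ℂ H) [GradedAlgebra 𝒜] (ζ : H →ₐ[ℂ] ℂ) : H →ₐ[ℂ] ℂ :=
  convChar (barChar 𝒜 (invChar ζ)) ζ

variable {H' : Type*} [CommRing H'] [HopfAlgebra ℂ H']

/-- A linear map is a morphism of graded Hopf algebras. -/
structure IsGradedHopfMorphism (𝒜 : ℕ → Submodule ℂ H) (ℬ : ℕ → Submodule ℂ H')
    (f : H →ₗ[ℂ] H') : Prop where
  map_one : f 1 = 1
  map_mul : ∀ x y, f (x * y) = f x * f y
  map_comul : ∀ x, Coalgebra.comul (R := ℂ) (f x) =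
    TensorProduct.map f f (Coalgebra.comul (R := ℂ) x)
  map_counit : ∀ x, Coalgebra.counit (R := ℂ) (f x) = Coalgebra.counit (R := ℂ) x
  map_antipode : ∀ x, f (HopfAlgebra.antipode ℂ x) = HopfAlgebra.antipode ℂ (f x)
  map_degree : ∀ n, ∀ x ∈ 𝒜 n, f x ∈ ℬ n

/-- A morphism `(H, ζ) → (H', ζ')` of combinatorial Hopf algebras, that is, of connected graded Hopf
algebras with a character. -/
structure IsCombinatorialMorphism (𝒜 : ℕ → Submodule ℂ H) [GradedAlgebra 𝒜] [ConnectedGraded 𝒜]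
    (ζ : H →ₐ[ℂ] ℂ) (ℬ : ℕ → Submodule ℂ H') [GradedAlgebra ℬ] [ConnectedGraded ℬ]
    (ζ' : H' →ₐ[ℂ] ℂ) (f : H →ₗ[ℂ] H') : Prop extends IsGradedHopfMorphism 𝒜 ℬ f where
  map_char : ∀ x, ζ' (f x) = ζ x

/-- `f` is the unique morphism `(H, ζ) → (H', ζ')` of combinatorial Hopf algebras. -/
def IsUniqueMorphism (𝒜 : ℕ → Submodule ℂ H) [GradedAlgebra 𝒜] [ConnectedGraded 𝒜]
    (ζ : H →ₐ[ℂ] ℂ) (ℬ : ℕ → Submodule ℂ H') [GradedAlgebra ℬ] [ConnectedGraded ℬ]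
    (ζ' : H' →ₐ[ℂ] ℂ) (f : H →ₗ[ℂ] H') : Prop :=
  IsCombinatorialMorphism 𝒜 ζ ℬ ζ' f ∧
    ∀ g : H →ₗ[ℂ] H', IsCombinatorialMorphism 𝒜 ζ ℬ ζ' g → g = f

/-- `Θ` is a theta map for the combinatorial Hopf algebra `(H, ζ)`: a graded Hopf morphism with
`Θ_QSym ∘ Φ = Φ ∘ Θ`, where `Φ : (H, ζ) → (QSym, ζ_QSym)` and
`Θ_QSym : (QSym, \overline{ζ_QSym^{-1}} ζ_QSym) → (QSym, ζ_QSym)` are the unique morphisms of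
combinatorial Hopf algebras. -/
def IsThetaMap (𝒜 : ℕ → Submodule ℂ H) [GradedAlgebra 𝒜] [ConnectedGraded 𝒜] (ζ : H →ₐ[ℂ] ℂ)
    (Θ : H →ₗ[ℂ] H) : Prop :=
  IsGradedHopfMorphism 𝒜 𝒜 Θ ∧
    ∃ (Φ : H →ₗ[ℂ] QSym) (ΘQSym : QSym →ₗ[ℂ] QSym),
      IsUniqueMorphism 𝒜 ζ QSym.grading zetaQSym Φ ∧
      IsUniqueMorphism QSym.grading (thetaChar QSym.grading zetaQSym) QSym.grading zetaQSym
        ΘQSym ∧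
      ΘQSym ∘ₗ Φ = Φ ∘ₗ Θ

/-- A peak algebra for `(H, ζ)` is the image of a theta map. -/
def IsPeakAlgebra (𝒜 : ℕ → Submodule ℂ H) [GradedAlgebra 𝒜] [ConnectedGraded 𝒜] (ζ : H →ₐ[ℂ] ℂ)
    (P : Submodule ℂ H) : Prop :=
  ∃ Θ : H →ₗ[ℂ] H, IsThetaMap 𝒜 ζ Θ ∧ P = LinearMap.range Θ

end Characters

section SymmetricAlgebra

variable {ι V : Type*} [AddCommGroup V] [Module ℂ V]

/-- The Hopf algebra structure of `Sym(V)`, with the elements of `V` primitive. -/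
instance : HopfAlgebra ℂ (SymmetricAlgebra ℂ V) where
  antipode := (SymmetricAlgebra.lift (-SymmetricAlgebra.ι ℂ V)).toLinearMap
  mul_antipode_rTensor_comul := by
    have h : (Algebra.TensorProduct.lmul' ℂ).comp ((Algebra.TensorProduct.map
        (SymmetricAlgebra.lift (-SymmetricAlgebra.ι ℂ V)) (AlgHom.id ℂ _)).comp
        (Bialgebra.comulAlgHom ℂ (SymmetricAlgebra ℂ V))) =
        (Algebra.ofId ℂ _).comp (Bialgebra.counitAlgHom ℂ _) := by
      apply SymmetricAlgebra.algHom_ext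
      ext x
      simp [SymmetricAlgebra.algebraMapInv_ι]
    exact congrArg AlgHom.toLinearMap h
  mul_antipode_lTensor_comul := by
    have h : (Algebra.TensorProduct.lmul' ℂ).comp ((Algebra.TensorProduct.map
        (AlgHom.id ℂ _) (SymmetricAlgebra.lift (-SymmetricAlgebra.ι ℂ V))).comp
        (Bialgebra.comulAlgHom ℂ (SymmetricAlgebra ℂ V))) =
        (Algebra.ofId ℂ _).comp (Bialgebra.counitAlgHom ℂ _) := by
      apply SymmetricAlgebra.algHom_ext
      ext x
      simp [SymmetricAlgebra.algebraMapInv_ι]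
    exact congrArg AlgHom.toLinearMap h

variable (v : Module.Basis ι ℂ V) (d : ι → ℕ+)

/-- The element `\overline{v_α} = \overline{v_{α_1} v_{α_2} ⋯}` of `Sym(V)`, for a word `α` in the
index set of the basis. -/
def word (α : List ι) : SymmetricAlgebra ℂ V :=
  (α.map fun i => SymmetricAlgebra.ι ℂ V (v i)).prod

/-- The degree of the word `v_α`, where `v_i` has degree `d i`. -/
def wordDegree (α : List ι) : ℕ := (α.map fun i => (d i : ℕ)).sum

/-- The degree `n` part of `Sym(V)`. -/
def symVGrading (n : ℕ) : Submodule ℂ (SymmetricAlgebra ℂ V) :=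
  Submodule.span ℂ {x | ∃ α : List ι, wordDegree d α = n ∧ word v α = x}

/-- `Sym(O(V))`, the span of the `\overline{v_α}` with all letters of odd degree. -/
def symOdd : Submodule ℂ (SymmetricAlgebra ℂ V) :=
  Submodule.span ℂ {x | ∃ α : List ι, (∀ i ∈ α, Odd (d i : ℕ)) ∧ word v α = x}

/-- The morphism `Φ_{Sym(V)} : Sym(V) → Sym`, `v_i ↦ p_{deg v_i}`. -/
def phiSymV : SymmetricAlgebra ℂ V →ₐ[ℂ] Sym :=
  SymmetricAlgebra.lift (v.constr ℂ fun i => p (d i))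

/-- The canonical character of `Sym(V)`, `v_i ↦ 1 / deg v_i`. -/
def zetaSymV : SymmetricAlgebra ℂ V →ₐ[ℂ] ℂ :=
  SymmetricAlgebra.lift (v.constr ℂ fun i => 1 / ((d i : ℕ) : ℂ))

/-- The exponent vector of a word. -/
def wordExp (α : List ι) : ι →₀ ℕ := (α.map fun i => Finsupp.single i 1).sum

theorem word_eq (α : List ι) : word v α = v.symmetricAlgebra (wordExp α) := by
  have h : ∀ m : ι →₀ ℕ, v.symmetricAlgebra m =
      (SymmetricAlgebra.equivMvPolynomial v).symm (MvPolynomial.monomial m 1) := by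
    intro m
    simp [Module.Basis.symmetricAlgebra]
  rw [h]
  induction α with
  | nil =>
    rw [word, wordExp]
    simp
  | cons a α ih =>
    have h1 : word v (a :: α) = SymmetricAlgebra.ι ℂ V (v a) * word v α := by simp [word]
    have h2 : wordExp (a :: α) = Finsupp.single a 1 + wordExp α := by simp [wordExp]
    have h3 : (MvPolynomial.monomial (Finsupp.single a 1 + wordExp α) (1 : ℂ)) =
        MvPolynomial.X a * MvPolynomial.monomial (wordExp α) 1 := by
      rw [MvPolynomial.X, MvPolynomial.monomial_mul, one_mul]
    rw [h1, h2, ih, h3, map_mul, SymmetricAlgebra.equivMvPolynomial_symm_X]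

theorem exists_word (m : ι →₀ ℕ) : ∃ α : List ι, wordExp α = m := by
  induction m using Finsupp.induction_linear with
  | zero => exact ⟨[], rfl⟩
  | add f g hf hg =>
    obtain ⟨α, rfl⟩ := hf
    obtain ⟨β, rfl⟩ := hg
    exact ⟨α ++ β, by simp [wordExp]⟩
  | single i n =>
    refine ⟨List.replicate n i, ?_⟩
    simp [wordExp]

theorem degree_wordExp (α : List ι) : (wordExp α).degree = α.length := by
  induction α with
  | nil => simp [wordExp]
  | cons a α ih =>
    have h2 : wordExp (a :: α) = Finsupp.single a 1 + wordExp α := by simp [wordExp]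
    rw [h2, map_add, ih, Finsupp.degree_single, List.length_cons, add_comm]

theorem mem_support_wordExp (α : List ι) (i : ι) : i ∈ (wordExp α).support ↔ i ∈ α := by
  induction α with
  | nil => simp [wordExp]
  | cons a α ih =>
    have h2 : wordExp (a :: α) = Finsupp.single a 1 + wordExp α := by simp [wordExp]
    rw [Finsupp.mem_support_iff] at ih ⊢
    rw [h2, Finsupp.add_apply, List.mem_cons, ← ih]
    by_cases h : a = i
    · subst h; simp
    · simp [Ne.symm h]

open Classical in
/-- The linear map `Θ_{Sym(V)}` that multiplies the monomials of length `ℓ` in the basis vectors of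
odd degree by `2^ℓ` and maps all other monomials to `0`. -/
def thetaSymV : SymmetricAlgebra ℂ V →ₗ[ℂ] SymmetricAlgebra ℂ V :=
  v.symmetricAlgebra.constr ℂ fun m =>
    if ∀ i ∈ m.support, Odd (d i : ℕ) then (2 : ℂ) ^ m.degree • v.symmetricAlgebra m else 0

open Classical in
theorem thetaSymV_word (α : List ι) : thetaSymV v d (word v α) =
    if ∀ i ∈ α, Odd (d i : ℕ) then (2 : ℂ) ^ α.length • word v α else 0 := by
  rw [word_eq, thetaSymV, Module.Basis.constr_basis, degree_wordExp]
  simp only [mem_support_wordExp]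

/-- The degree of a monomial. -/
def expDegree (m : ι →₀ ℕ) : ℕ := m.sum fun i n => n * (d i : ℕ)

theorem expDegree_wordExp (α : List ι) : expDegree d (wordExp α) = wordDegree d α := by
  induction α with
  | nil => simp [wordExp, expDegree, wordDegree]
  | cons a α ih =>
    have h2 : wordExp (a :: α) = Finsupp.single a 1 + wordExp α := by simp [wordExp]
    have h3 : wordDegree d (a :: α) = d a + wordDegree d α := by simp [wordDegree]
    rw [h2, h3, ← ih, expDegree, Finsupp.sum_add_index' (by simp) (by intros; ring),
      Finsupp.sum_single_index (by simp), one_mul]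
    rfl

theorem symVGrading_eq : symVGrading v d = weightSpan v.symmetricAlgebra (expDegree d) := by
  funext n
  rw [symVGrading, weightSpan]
  congr 1
  ext x
  constructor
  · rintro ⟨α, h1, h2⟩
    exact ⟨wordExp α, by rw [expDegree_wordExp, h1], by rw [← word_eq, h2]⟩
  · rintro ⟨m, h1, h2⟩
    obtain ⟨α, rfl⟩ := exists_word m
    exact ⟨α, by rw [← expDegree_wordExp, h1], by rw [word_eq, h2]⟩

theorem word_mem_symVGrading (α : List ι) : word v α ∈ symVGrading v d (wordDegree d α) :=
  Submodule.subset_span ⟨α, rfl, rfl⟩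

theorem word_append (α β : List ι) : word v (α ++ β) = word v α * word v β := by simp [word]

theorem wordDegree_append (α β : List ι) :
    wordDegree d (α ++ β) = wordDegree d α + wordDegree d β := by simp [wordDegree]

instance : SetLike.GradedMonoid (symVGrading v d) where
  one_mem := Submodule.subset_span ⟨[], rfl, rfl⟩
  mul_mem := by
    intro i j f g hf hg
    have h := Submodule.mul_mem_mul hf hg
    rw [symVGrading, symVGrading, Submodule.span_mul_span] at h
    refine Submodule.span_mono ?_ h
    rintro _ ⟨_, ⟨α, rfl, rfl⟩, _, ⟨β, rfl, rfl⟩, rfl⟩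
    exact ⟨α ++ β, wordDegree_append d α β, word_append v α β⟩

instance : DirectSum.Decomposition (symVGrading v d) :=
  symVGrading_eq v d ▸ weightDecomposition v.symmetricAlgebra (expDegree d)

instance : GradedAlgebra (symVGrading v d) where

theorem comul_word (α : List ι) : Coalgebra.comul (R := ℂ) (word v α) ∈
    tensorDegree (symVGrading v d) (wordDegree d α) := by
  induction α with
  | nil =>
    have h : word v ([] : List ι) = 1 := rfl
    rw [h, Bialgebra.comul_one, Algebra.TensorProduct.one_def]
    exact tmul_mem_tensorDegree (i := 0) (j := 0) rfl SetLike.GradedOne.one_mem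
      SetLike.GradedOne.one_mem
  | cons a α ih =>
    have h1 : word v (a :: α) = SymmetricAlgebra.ι ℂ V (v a) * word v α := by simp [word]
    have h3 : wordDegree d (a :: α) = d a + wordDegree d α := by simp [wordDegree]
    have ha : SymmetricAlgebra.ι ℂ V (v a) ∈ symVGrading v d (d a) :=
      Submodule.subset_span ⟨[a], by simp [wordDegree], by simp [word]⟩
    rw [h1, h3, Bialgebra.comul_mul, SymmetricAlgebra.comul_ι]
    refine mul_mem_tensorDegree (Submodule.add_mem _ ?_ ?_) ih
    · exact tmul_mem_tensorDegree (add_zero _) ha SetLike.GradedOne.one_mem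
    · exact tmul_mem_tensorDegree (zero_add _) SetLike.GradedOne.one_mem ha

instance : ConnectedGraded (symVGrading v d) where
  connected := by
    rw [symVGrading_eq]
    refine weightSpan_zero _ _ (k₀ := 0) ?_ ?_
    · rw [← show wordExp ([] : List ι) = 0 from rfl, ← word_eq]
      rfl
    · intro m
      obtain ⟨α, rfl⟩ := exists_word m
      rw [expDegree_wordExp]
      cases α with
      | nil => simp [wordDegree, wordExp]
      | cons a α =>
        have := (d a).pos
        have h2 := mem_support_wordExp (a :: α) a
        constructor
        · intro h
          simp [wordDegree] at h
        · intro h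
          rw [h] at h2
          simp at h2
  comul_mem := by
    intro n x hx
    induction hx using Submodule.span_induction with
    | mem x hx =>
      obtain ⟨α, rfl, rfl⟩ := hx
      exact comul_word v d α
    | zero => simp
    | add x y _ _ hx hy => rw [map_add]; exact Submodule.add_mem _ hx hy
    | smul c x _ hx => rw [map_smul]; exact Submodule.smul_mem _ c hx
  counit_eq := by
    intro n hn x hx
    induction hx using Submodule.span_induction with
    | mem x hx =>
      obtain ⟨α, rfl, rfl⟩ := hx
      cases α with
      | nil => exact absurd rfl hn
      | cons a α =>
        have h1 : word v (a :: α) = SymmetricAlgebra.ι ℂ V (v a) * word v α := by simp [word]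
        rw [h1, Bialgebra.counit_mul, SymmetricAlgebra.counit_ι, zero_mul]
    | zero => simp
    | add x y _ _ hx hy => rw [map_add, hx, hy, add_zero]
    | smul c x _ hx => rw [map_smul, hx, smul_zero]

end SymmetricAlgebra


end PeakTheta

end

/-! Every map in the statement is an algebra morphism that is controlled by its values on primitive
elements. The scalar `1 - (-1)^n` is `2` for odd `n` and `0` for even `n`. Hence `Θ_{Sym(V)}` is the
algebra endomorphism that scales `v_i` by `1 - (-1)^{deg v_i}`. A multiple of a primitive element is
primitive, so this endomorphism is a Hopf morphism (`thetaSymVHom_toLinearMap`,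
`thetaSymV_isGradedHopfMorphism`).

The other maps come from the terminality of `QSym`. For a connected graded Hopf algebra with
character `ζ`, let `ζ_α` be the convolution product of the parts of `ζ` in the degrees `α_1, α_2,
…`. Then `x ↦ ∑_α ζ_α(x) M_α` is the only morphism to `QSym` compatible with the characters
(`univ_isUniqueMorphism`). The reason is that a coalgebra morphism to `QSym` is determined by its
coefficients at the `M_{(a)}` (`coalgHom_ext`), and these are prescribed by the character. If the
source is cocommutative, then `ζ_α` does not depend on the order of the parts, so the morphism lands
in `Sym` (`univSym_isUniqueMorphism`).

On a primitive `x` of degree `n > 0` the universal morphism gives `ζ(x) M_{(n)}`, and the theta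
character takes the value `(1 - (-1)^n) ζ(x)` (`univ_primitive`, `thetaChar_primitive`). So `Θ_Sym`
and `Θ_QSym` scale `p_n` and `M_{(n)}` by the same scalar by which `Θ_{Sym(V)}` scales a `v_i` of
degree `n`. Both intertwining identities therefore hold on the generators `v_i`, hence everywhere.
-/

noncomputable section

namespace PeakTheta

open WithConv Coalgebra

/-! ### Morphisms of Hopf algebras and antipodes. -/

section HopfMorphisms

variable {H : Type*} [CommRing H] [HopfAlgebra ℂ H] {H' : Type*} [CommRing H'] [HopfAlgebra ℂ H']

/-- A morphism of bialgebras between Hopf algebras commutes with the antipodes. -/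
theorem bialgHom_antipode (f : H →ₐc[ℂ] H') (x : H) :
    f (HopfAlgebra.antipode ℂ x) = HopfAlgebra.antipode ℂ (f x) := by
  let F : H →ₐ[ℂ] H' := f
  let G : H →ₗc[ℂ] H' := f
  -- In the convolution algebra of maps `H → H'`, the composites `F ∘ S` and `S ∘ F` are a left and
  -- a right inverse of `F`, so they coincide.
  have h1 : toConv (F.toLinearMap ∘ₗ HopfAlgebra.antipode ℂ) * toConv F.toLinearMap = 1 := by
    have h := LinearMap.algHom_comp_convMul_distrib F
      (toConv (HopfAlgebra.antipode ℂ (A := H))) (toConv LinearMap.id)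
    rw [LinearMap.antipode_mul_id] at h
    apply ofConv_injective
    refine h.symm.trans ?_
    ext x
    simp [LinearMap.convOne_def]
  have h2 : toConv F.toLinearMap * toConv (HopfAlgebra.antipode ℂ ∘ₗ F.toLinearMap) = 1 := by
    have h := LinearMap.convMul_comp_coalgHom_distrib
      (toConv LinearMap.id) (toConv (HopfAlgebra.antipode ℂ (A := H'))) G
    rw [LinearMap.id_mul_antipode] at h
    apply ofConv_injective
    refine h.symm.trans ?_
    ext x
    simp [LinearMap.convOne_def, G]
  exact congrArg (fun g => g.ofConv x) (left_inv_eq_right_inv h1 h2)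

/-- A degree preserving algebra morphism that is compatible with the coproducts and the counits is
a morphism of graded Hopf algebras. -/
theorem IsGradedHopfMorphism.of_algHom {𝒜 : ℕ → Submodule ℂ H} {ℬ : ℕ → Submodule ℂ H'}
    (f : H →ₐ[ℂ] H')
    (comul : ∀ x, Coalgebra.comul (R := ℂ) (f x) =
      TensorProduct.map f.toLinearMap f.toLinearMap (Coalgebra.comul (R := ℂ) x))
    (counit : ∀ x, Coalgebra.counit (R := ℂ) (f x) = Coalgebra.counit (R := ℂ) x)
    (degree : ∀ n, ∀ x ∈ 𝒜 n, f x ∈ ℬ n) : IsGradedHopfMorphism 𝒜 ℬ f.toLinearMap where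
  map_one := _root_.map_one f
  map_mul := _root_.map_mul f
  map_comul := comul
  map_counit := counit
  map_antipode := bialgHom_antipode (BialgHom.ofAlgHom f (AlgHom.ext counit)
    (AlgHom.ext fun x => (comul x).symm))
  map_degree := degree

/-- The antipode of a primitive element. -/
theorem antipode_primitive {x : H} (h : comul (R := ℂ) x = x ⊗ₜ 1 + 1 ⊗ₜ x)
    (hx : counit (R := ℂ) x = 0) : HopfAlgebra.antipode ℂ x = -x := by
  have h1 := HopfAlgebra.mul_antipode_rTensor_comul_apply (R := ℂ) x
  rw [h, hx] at h1
  -- The antipode axiom reads `S(x) · 1 + S(1) · x = 0`, and `S(1) = 1`.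
  simpa [add_eq_zero_iff_eq_neg] using h1

end HopfMorphisms

/-! ### Reduction to homogeneous elements. -/

section Homogeneous

variable {H : Type*} [Ring H] [Algebra ℂ H] (𝒜 : ℕ → Submodule ℂ H) [GradedAlgebra 𝒜]

theorem linearMap_ext_homogeneous {W : Type*} [AddCommMonoid W] [Module ℂ W] {f g : H →ₗ[ℂ] W}
    (h : ∀ n, ∀ x ∈ 𝒜 n, f x = g x) : f = g := by
  ext x
  induction x using DirectSum.Decomposition.inductionOn 𝒜 with
  | zero => simp
  | add x y hx hy => rw [map_add, map_add, hx, hy]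
  | homogeneous x => exact h _ x x.2

theorem proj_same {n : ℕ} {x : H} (hx : x ∈ 𝒜 n) : GradedAlgebra.proj 𝒜 n x = x := by
  rw [GradedAlgebra.proj_apply, DirectSum.decompose_of_mem_same 𝒜 hx]

theorem proj_ne {m n : ℕ} {x : H} (hx : x ∈ 𝒜 m) (h : m ≠ n) : GradedAlgebra.proj 𝒜 n x = 0 := by
  rw [GradedAlgebra.proj_apply, DirectSum.decompose_of_mem_ne 𝒜 hx h]

end Homogeneous

/-! ### Monomial coordinates on `QSym` and coalgebra morphisms into it. -/

section Coordinates

/-- The coefficient of `M_α`, as an element of the convolution algebra. -/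
def coordConv (α : List ℕ+) : WithConv (QSym →ₗ[ℂ] ℂ) := toConv (basisM.coord α)

/-- The coproduct of `QSym` is deconcatenation, which is dual to concatenation of compositions. -/
theorem coordConv_append (α β : List ℕ+) : coordConv (α ++ β) = coordConv α * coordConv β := by
  apply ofConv_injective
  ext f
  have h : ∀ t : QSym ⊗[ℂ] QSym, (basisM.tensorProduct basisM).repr t (α, β) =
      LinearMap.mul' ℂ ℂ (TensorProduct.map (basisM.coord α) (basisM.coord β) t) := by
    intro t
    induction t with
    | zero => simp
    | add x y hx hy => simp only [map_add, Finsupp.add_apply, hx, hy]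
    | tmul x y => simp [mul_comm]
  exact (basisComul_repr basisM listFactorization f α β).symm.trans (h _)

/-- In degree `n` the only power of `x_0` that can occur is `x_0^n`, and quasisymmetry identifies
its coefficient with that of `M_{(n)}`. This is the bridge between characters and the one-part
coordinates. -/
theorem coord_singleton_eq_zeta {n : ℕ+} {f : QSym} (hf : f ∈ QSym.grading n) :
    basisM.repr f [n] = zetaQSym f := by
  have h : zetaQSym f = ∑ᶠ k, MvPowerSeries.coeff (Finsupp.single 0 k)
    (f : MvPowerSeries ℕ ℂ) := rfl
  rw [h, finsum_eq_single _ (n : ℕ), basisM_repr]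
  · refine coeff_eq_of_exps f.2.2 ?_
    have hs : (Finsupp.single 0 (n : ℕ) : ℕ →₀ ℕ).support = {0} := by
      ext i
      simp [eq_comm, n.ne_zero.symm]
    rw [exps_ofComp, exps, hs]
    simp
  · intro k hk
    by_contra h0
    exact hk (by simpa using QSym.mem_grading.1 hf _ h0)

theorem coord_eq_zero {n : ℕ} {f : QSym} (hf : f ∈ QSym.grading n) {α : List ℕ+}
    (h : size α ≠ n) : basisM.repr f α = 0 := by
  by_contra h0
  rw [QSym.grading_eq, mem_weightSpan] at hf
  exact h (hf α h0)

variable {C : Type*} [AddCommGroup C] [Module ℂ C] [Coalgebra ℂ C]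

/-- Composition with a coalgebra morphism respects convolution, so the factorization of the
coordinates in `coordConv_append` pulls back to `C`. -/
theorem coord_comp_eq_prod (f : C →ₗc[ℂ] QSym) (α : List ℕ+) :
    toConv (basisM.coord α ∘ₗ f.toLinearMap) =
      (α.map fun a => toConv (basisM.coord [a] ∘ₗ f.toLinearMap)).prod := by
  induction α with
  | nil =>
    apply ofConv_injective
    ext x
    -- The coordinate at the empty composition is the counit of `QSym` by definition, and the empty
    -- convolution product is the counit of `C`.
    exact CoalgHomClass.counit_comp_apply f x
  | cons a α ih =>
    rw [List.map_cons, List.prod_cons, ← ih]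
    apply ofConv_injective
    have h := LinearMap.convMul_comp_coalgHom_distrib (coordConv [a]) (coordConv α) f
    rw [← coordConv_append] at h
    exact h

/-- A morphism of coalgebras to `QSym` is determined by the coefficients of the `M_{(a)}`. -/
theorem coalgHom_ext {f g : C →ₗc[ℂ] QSym}
    (h : ∀ a x, basisM.repr (f x) [a] = basisM.repr (g x) [a]) : f = g := by
  ext x : 1
  refine basisM.ext_elem fun α => ?_
  have hfg : ∀ a, basisM.coord [a] ∘ₗ f.toLinearMap = basisM.coord [a] ∘ₗ g.toLinearMap :=
    fun a => LinearMap.ext (h a)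
  have h1 := coord_comp_eq_prod f α
  simp only [hfg] at h1
  rw [← coord_comp_eq_prod g α] at h1
  exact congrArg (fun F => F.ofConv x) h1

end Coordinates

end PeakTheta

namespace PeakTheta

open WithConv Coalgebra

/-! ### `QSym` as the terminal combinatorial Hopf algebra. -/

section Universal

variable {H : Type*} [CommRing H] [HopfAlgebra ℂ H]
variable (𝒜 : ℕ → Submodule ℂ H) [GradedAlgebra 𝒜] (ζ : H →ₐ[ℂ] ℂ)

/-- The restriction of a character to degree `a`, extended by zero. -/
def charPart (a : ℕ+) : WithConv (H →ₗ[ℂ] ℂ) :=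
  toConv (ζ.toLinearMap ∘ₗ GradedAlgebra.proj 𝒜 a)

/-- The convolution product of the parts of a character in the degrees `α_1, α_2, …`. -/
def compChar (α : List ℕ+) : WithConv (H →ₗ[ℂ] ℂ) := (α.map (charPart 𝒜 ζ)).prod

theorem compChar_cons (a : ℕ+) (α : List ℕ+) :
    compChar 𝒜 ζ (a :: α) = charPart 𝒜 ζ a * compChar 𝒜 ζ α := by
  simp [compChar]

theorem charPart_same {a : ℕ+} {x : H} (hx : x ∈ 𝒜 a) : (charPart 𝒜 ζ a).ofConv x = ζ x := by
  simp [charPart, proj_same 𝒜 hx]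

theorem charPart_ne {a : ℕ+} {n : ℕ} (h : n ≠ a) {x : H} (hx : x ∈ 𝒜 n) :
    (charPart 𝒜 ζ a).ofConv x = 0 := by
  simp [charPart, proj_ne 𝒜 hx h]

variable [ConnectedGraded 𝒜]

/-- By induction `ζ_α` lives in degree `|α|`: in a tensor `y ⊗ z` of the coproduct, the first factor
must have degree `a` and the second the size of the remaining composition. This makes the sum `∑_α
ζ_α(x) M_α` finite and degree preserving. -/
theorem compChar_eq_zero (α : List ℕ+) : ∀ {n : ℕ}, size α ≠ n → ∀ x ∈ 𝒜 n,
    (compChar 𝒜 ζ α).ofConv x = 0 := by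
  induction α with
  | nil =>
    intro n hn x hx
    exact ConnectedGraded.counit_eq (𝒜 := 𝒜) n (Ne.symm hn) x hx
  | cons a α ih =>
    intro n hn x hx
    rw [compChar_cons, LinearMap.convMul_def]
    have h : tensorDegree 𝒜 n ≤ LinearMap.ker
        (TensorProduct.map (charPart 𝒜 ζ a).ofConv (compChar 𝒜 ζ α).ofConv) := by
      refine tensorDegree_le fun i j hij y hy z hz => ?_
      rw [LinearMap.mem_ker, TensorProduct.map_tmul]
      by_cases hi : i = a
      · have hs : size (a :: α) = a + size α := by simp [size]
        rw [ih (n := j) (by omega) z hz, TensorProduct.tmul_zero]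
      · rw [charPart_ne 𝒜 ζ hi hy, TensorProduct.zero_tmul]
    have h2 := LinearMap.mem_ker.1 (h (ConnectedGraded.comul_mem n x hx))
    simp only [LinearMap.comp_apply, h2, map_zero]

theorem finite_compChar (x : H) : {α | (compChar 𝒜 ζ α).ofConv x ≠ 0}.Finite := by
  induction x using DirectSum.Decomposition.inductionOn 𝒜 with
  | zero => simp
  | add x y hx hy =>
    refine (hx.union hy).subset fun α hα => ?_
    by_contra h
    simp only [Set.mem_union, Set.mem_ofPred_eq, not_or, not_not] at h hα
    exact hα (by rw [map_add, h.1, h.2, add_zero])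
  | @homogeneous n x =>
    refine (finite_size_le n).subset fun α hα => ?_
    by_contra h
    exact hα (compChar_eq_zero 𝒜 ζ α (fun h' => h h'.le) x x.2)

/-- The map `x ↦ ∑_α ζ_α(x) M_α`, where `ζ_α` is the convolution product of the parts of `ζ` in the
degrees `α_1, α_2, …`. -/
def univLinear : H →ₗ[ℂ] QSym :=
  basisM.repr.symm.toLinearMap ∘ₗ
    { toFun x := Finsupp.ofSupportFinite (fun α => (compChar 𝒜 ζ α).ofConv x)
        (finite_compChar 𝒜 ζ x)
      map_add' x y := Finsupp.ext fun α => map_add (compChar 𝒜 ζ α).ofConv x y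
      map_smul' c x := Finsupp.ext fun α => map_smul (compChar 𝒜 ζ α).ofConv c x }

theorem univLinear_repr (x : H) (α : List ℕ+) :
    basisM.repr (univLinear 𝒜 ζ x) α = (compChar 𝒜 ζ α).ofConv x := by
  rw [univLinear, LinearMap.comp_apply, LinearEquiv.coe_coe, LinearEquiv.apply_symm_apply]
  rfl

theorem univLinear_repr_singleton (x : H) (a : ℕ+) :
    basisM.repr (univLinear 𝒜 ζ x) [a] = (charPart 𝒜 ζ a).ofConv x := by
  rw [univLinear_repr]
  simp [compChar]

theorem univLinear_mem {n : ℕ} {x : H} (hx : x ∈ 𝒜 n) : univLinear 𝒜 ζ x ∈ QSym.grading n := by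
  rw [QSym.grading_eq, mem_weightSpan]
  intro α hα
  rw [univLinear_repr] at hα
  by_contra h
  exact hα (compChar_eq_zero 𝒜 ζ α h x hx)

theorem univLinear_one : univLinear 𝒜 ζ 1 = 1 := by
  refine basisM.ext_elem fun α => ?_
  rw [univLinear_repr, ← M_nil, ← basisM_apply, basisM.repr_self]
  by_cases hα : α = []
  · subst hα
    rw [Finsupp.single_eq_same]
    exact Bialgebra.counit_one
  · rw [Finsupp.single_eq_of_ne hα]
    exact compChar_eq_zero 𝒜 ζ α (n := 0) (by rwa [Ne, size_eq_zero]) 1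
      SetLike.GradedOne.one_mem

theorem zetaQSym_univLinear (x : H) : zetaQSym (univLinear 𝒜 ζ x) = ζ x := by
  suffices h : zetaQSym.toLinearMap ∘ₗ univLinear 𝒜 ζ = ζ.toLinearMap from
    congrArg (fun f => f x) h
  refine linearMap_ext_homogeneous 𝒜 fun n x hx => ?_
  simp only [LinearMap.comp_apply, AlgHom.toLinearMap_apply]
  -- One-part coordinates recover the character only in positive degree. Degree zero consists of
  -- scalars by connectedness.
  rcases Nat.eq_zero_or_pos n with rfl | hn
  · rw [ConnectedGraded.connected (𝒜 := 𝒜)] at hx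
    obtain ⟨c, rfl⟩ := Submodule.mem_one.1 hx
    rw [Algebra.algebraMap_eq_smul_one, map_smul, map_smul, map_smul, univLinear_one, map_one, map_one]
  · lift n to ℕ+ using hn
    rw [← coord_singleton_eq_zeta (univLinear_mem 𝒜 ζ hx), univLinear_repr_singleton,
      charPart_same 𝒜 ζ hx]

/-- `univLinear` as a morphism of coalgebras. -/
def univCoalgHom : H →ₗc[ℂ] QSym where
  toLinearMap := univLinear 𝒜 ζ
  counit_comp := LinearMap.ext fun x => univLinear_repr 𝒜 ζ x []
  map_comp_comul := by
    ext x
    refine (basisM.tensorProduct basisM).ext_elem ?_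
    rintro ⟨α, β⟩
    have h : ∀ t : H ⊗[ℂ] H, (basisM.tensorProduct basisM).repr
        (TensorProduct.map (univLinear 𝒜 ζ) (univLinear 𝒜 ζ) t) (α, β) =
        LinearMap.mul' ℂ ℂ
          (TensorProduct.map (compChar 𝒜 ζ α).ofConv (compChar 𝒜 ζ β).ofConv t) := by
      intro t
      induction t with
      | zero => simp
      | add x y hx hy => simp only [map_add, Finsupp.add_apply, hx, hy]
      | tmul x y => simp [univLinear_repr, mul_comm]
    -- At `(α, β)` the two sides are `ζ_α * ζ_β` and `ζ_{αβ}` evaluated at `x`, and these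
    -- functionals are equal by construction.
    refine (h _).trans (Eq.trans ?_ (basisComul_repr basisM listFactorization _ α β).symm)
    have h2 : compChar 𝒜 ζ (α ++ β) = compChar 𝒜 ζ α * compChar 𝒜 ζ β := by simp [compChar]
    exact (congrArg (fun f => f.ofConv x) h2).symm.trans (univLinear_repr 𝒜 ζ x (α ++ β)).symm

/-- In a bialgebra the product is a coalgebra morphism, so both sides come from coalgebra morphisms
`H ⊗ H → QSym`. By `coalgHom_ext` it is enough to compare one-part coordinates, where the claim
becomes the multiplicativity of `ζ` and of `zetaQSym`. -/
theorem univLinear_mul (x y : H) :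
    univLinear 𝒜 ζ (x * y) = univLinear 𝒜 ζ x * univLinear 𝒜 ζ y := by
  have h : (univCoalgHom 𝒜 ζ).comp (Bialgebra.mulCoalgHom ℂ H) =
      (Bialgebra.mulCoalgHom ℂ QSym).comp
        (Coalgebra.TensorProduct.map (univCoalgHom 𝒜 ζ) (univCoalgHom 𝒜 ζ)) := by
    refine coalgHom_ext fun a t => ?_
    have key : ∀ x y : H, basisM.repr (univLinear 𝒜 ζ (x * y)) [a] =
        basisM.repr (univLinear 𝒜 ζ x * univLinear 𝒜 ζ y) [a] := by
      intro x y
      suffices h : (LinearMap.mul ℂ H).compr₂ (basisM.coord [a] ∘ₗ univLinear 𝒜 ζ) =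
          ((LinearMap.mul ℂ QSym).compl₁₂ (univLinear 𝒜 ζ) (univLinear 𝒜 ζ)).compr₂
            (basisM.coord [a]) from
        congrArg (fun f => f x y) h
      refine linearMap_ext_homogeneous 𝒜 fun i x hx => ?_
      refine linearMap_ext_homogeneous 𝒜 fun j y hy => ?_
      have h1 : univLinear 𝒜 ζ (x * y) ∈ QSym.grading (i + j) :=
        univLinear_mem 𝒜 ζ (SetLike.mul_mem_graded hx hy)
      have h2 : univLinear 𝒜 ζ x * univLinear 𝒜 ζ y ∈ QSym.grading (i + j) :=
        SetLike.mul_mem_graded (univLinear_mem 𝒜 ζ hx) (univLinear_mem 𝒜 ζ hy)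
      change basisM.repr (univLinear 𝒜 ζ (x * y)) [a] =
        basisM.repr (univLinear 𝒜 ζ x * univLinear 𝒜 ζ y) [a]
      -- In the matching degree the coordinate at `[a]` is the value of `zetaQSym`; in any other
      -- degree both coordinates vanish.
      by_cases ha : (a : ℕ) = i + j
      · rw [← ha] at h1 h2
        rw [coord_singleton_eq_zeta h1, coord_singleton_eq_zeta h2, map_mul zetaQSym,
          zetaQSym_univLinear, zetaQSym_univLinear, zetaQSym_univLinear, map_mul ζ]
      · rw [coord_eq_zero h1 (by simpa [size] using ha),
          coord_eq_zero h2 (by simpa [size] using ha)]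
    induction t with
    | zero => simp
    | add s t hs ht => rw [map_add, map_add, map_add, map_add, Finsupp.add_apply,
        Finsupp.add_apply, hs, ht]
    | tmul x y => exact key x y
  exact congrArg (fun f => f (x ⊗ₜ[ℂ] y)) h

/-- `univLinear` as a morphism of algebras. -/
def univ : H →ₐ[ℂ] QSym :=
  AlgHom.ofLinearMap (univLinear 𝒜 ζ) (univLinear_one 𝒜 ζ) (univLinear_mul 𝒜 ζ)

theorem univ_repr (x : H) (α : List ℕ+) :
    basisM.repr (univ 𝒜 ζ x) α = (compChar 𝒜 ζ α).ofConv x :=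
  univLinear_repr 𝒜 ζ x α

theorem univ_comul (x : H) : comul (R := ℂ) (univ 𝒜 ζ x) =
    TensorProduct.map (univ 𝒜 ζ).toLinearMap (univ 𝒜 ζ).toLinearMap (comul (R := ℂ) x) :=
  (CoalgHomClass.map_comp_comul_apply (univCoalgHom 𝒜 ζ) x).symm

theorem univ_counit (x : H) : counit (R := ℂ) (univ 𝒜 ζ x) = counit (R := ℂ) x :=
  univLinear_repr 𝒜 ζ x []

theorem univ_isCombinatorialMorphism :
    IsCombinatorialMorphism 𝒜 ζ QSym.grading zetaQSym (univ 𝒜 ζ).toLinearMap where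
  toIsGradedHopfMorphism := .of_algHom _ (univ_comul 𝒜 ζ) (univ_counit 𝒜 ζ)
    fun _ _ hx => univLinear_mem 𝒜 ζ hx
  map_char := zetaQSym_univLinear 𝒜 ζ

/-- A morphism of combinatorial Hopf algebras to `QSym` is unique. -/
theorem combinatorialMorphism_unique {f g : H →ₗ[ℂ] QSym}
    (hf : IsCombinatorialMorphism 𝒜 ζ QSym.grading zetaQSym f)
    (hg : IsCombinatorialMorphism 𝒜 ζ QSym.grading zetaQSym g) : f = g := by
  -- The one-part coordinates of any morphism are forced: in degree `a` they are the character, and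
  -- in all other degrees they are zero.
  have key : ∀ {f : H →ₗ[ℂ] QSym}, IsCombinatorialMorphism 𝒜 ζ QSym.grading zetaQSym f →
      ∀ a, basisM.coord [a] ∘ₗ f = (charPart 𝒜 ζ a).ofConv := by
    intro f hf a
    refine linearMap_ext_homogeneous 𝒜 fun n x hx => ?_
    have h := hf.map_degree n x hx
    rw [LinearMap.comp_apply, Module.Basis.coord_apply]
    by_cases hn : n = a
    · subst hn
      rw [coord_singleton_eq_zeta h, hf.map_char, charPart_same 𝒜 ζ hx]
    · rw [coord_eq_zero h (by simpa [size] using Ne.symm hn), charPart_ne 𝒜 ζ hn hx]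
  let F : H →ₗc[ℂ] QSym := ⟨f, LinearMap.ext hf.map_counit,
    LinearMap.ext fun x => (hf.map_comul x).symm⟩
  let G : H →ₗc[ℂ] QSym := ⟨g, LinearMap.ext hg.map_counit,
    LinearMap.ext fun x => (hg.map_comul x).symm⟩
  have h : F = G := coalgHom_ext fun a x =>
    congrArg (fun φ => φ x) ((key hf a).trans (key hg a).symm)
  exact congrArg CoalgHom.toLinearMap h

/-- `QSym` is the terminal combinatorial Hopf algebra. -/
theorem univ_isUniqueMorphism :
    IsUniqueMorphism 𝒜 ζ QSym.grading zetaQSym (univ 𝒜 ζ).toLinearMap :=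
  ⟨univ_isCombinatorialMorphism 𝒜 ζ, fun _ hg =>
    combinatorialMorphism_unique 𝒜 ζ hg (univ_isCombinatorialMorphism 𝒜 ζ)⟩

/-- Each tensor in the coproduct of `x` has `1` as a factor, and functionals supported in positive
degree vanish on `1`. Thus `ζ_α(x) = 0` once `α` has two or more parts, and the degree leaves only
`α = (n)`. -/
theorem univ_primitive {n : ℕ+} {x : H} (hx : x ∈ 𝒜 n)
    (h : comul (R := ℂ) x = x ⊗ₜ 1 + 1 ⊗ₜ x) : univ 𝒜 ζ x = ζ x • M [n] := by
  refine basisM.ext_elem fun α => ?_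
  rw [map_smul, ← basisM_apply, basisM.repr_self, Finsupp.smul_apply, univ_repr]
  by_cases hα : α = [n]
  · subst hα
    rw [Finsupp.single_eq_same, smul_eq_mul, mul_one, ← charPart_same 𝒜 ζ hx]
    simp [compChar]
  rw [Finsupp.single_eq_of_ne hα, smul_zero]
  by_cases hs : size α = n
  · rcases α with _ | ⟨a, _ | ⟨b, α⟩⟩
    · exact absurd hs.symm n.ne_zero
    · exact absurd (by simpa [size] using hs) hα
    · have h1 : (1 : H) ∈ 𝒜 0 := SetLike.GradedOne.one_mem
      rw [compChar_cons, LinearMap.convMul_def]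
      simp only [LinearMap.comp_apply, h, map_add, TensorProduct.map_tmul,
        LinearMap.mul'_apply]
      -- The term `x ⊗ 1` dies in its second factor because `b :: α` has positive size, and `1 ⊗ x`
      -- dies in its first because `a` is positive.
      rw [compChar_eq_zero 𝒜 ζ (b :: α) (by simp [size_eq_zero]) 1 h1,
        charPart_ne 𝒜 ζ (Ne.symm a.ne_zero) h1, mul_zero, zero_mul, add_zero]
  · exact compChar_eq_zero 𝒜 ζ α hs x hx

/-- Convolution of characters is additive on primitive elements. The inverse contributes a minus
sign through the antipode, and the bar contributes `(-1)^n`. -/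
theorem thetaChar_primitive {n : ℕ} (hn : n ≠ 0) {x : H} (hx : x ∈ 𝒜 n)
    (h : comul (R := ℂ) x = x ⊗ₜ 1 + 1 ⊗ₜ x) :
    thetaChar 𝒜 ζ x = (1 - (-1) ^ n) * ζ x := by
  have hS := antipode_primitive h (ConnectedGraded.counit_eq (𝒜 := 𝒜) n hn x hx)
  have hb : barChar 𝒜 (invChar ζ) x = -((-1) ^ n * ζ x) := by
    simp [barChar, invChar, degreeSign_apply 𝒜 hx, hS]
  simp only [thetaChar, convChar, AlgHom.comp_apply, Bialgebra.comulAlgHom_apply, h, map_add,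
    Algebra.TensorProduct.map_tmul, Algebra.TensorProduct.lmul'_apply_tmul, map_one, hb]
  ring

end Universal

/-! ### `Sym` as the terminal cocommutative combinatorial Hopf algebra. -/

section Cocommutative

/-- The coproduct of `Sym` splits multisets, and union of multisets is commutative. This allows
`Sym` itself as the source of `univSym`, which is how `Θ_Sym` is obtained. -/
instance : IsCocomm ℂ Sym where
  comm_comp_comul := by
    ext x
    refine (basisSym.tensorProduct basisSym).ext_elem ?_
    rintro ⟨s, t⟩
    have h : ∀ z : Sym ⊗[ℂ] Sym,
        (basisSym.tensorProduct basisSym).repr (TensorProduct.comm ℂ Sym Sym z) (s, t) =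
          (basisSym.tensorProduct basisSym).repr z (t, s) := by
      intro z
      induction z with
      | zero => simp
      | add x y hx hy => simp only [map_add, Finsupp.add_apply, hx, hy]
      | tmul x y => simp [mul_comm]
    refine (h _).trans ?_
    refine (basisComul_repr basisSym multisetFactorization x t s).trans
      (Eq.trans ?_ (basisComul_repr basisSym multisetFactorization x s t).symm)
    exact congrArg (basisSym.repr x) (add_comm t s)

theorem mem_Sym_of_perm {f : QSym} (h : ∀ α β : List ℕ+, α.Perm β →
    basisM.repr f α = basisM.repr f β) : (f : MvPowerSeries ℕ ℂ) ∈ Sym := by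
  refine ⟨f.2, fun σ m => ?_⟩
  obtain ⟨α, hα⟩ := exists_comp (m.embDomain σ.toEmbedding)
  obtain ⟨β, hβ⟩ := exists_comp m
  rw [coeff_eq_of_exps f.2.2 (m' := ofComp α) (by rw [exps_ofComp, hα]),
    coeff_eq_of_exps f.2.2 (m := m) (m' := ofComp β) (by rw [exps_ofComp, hβ])]
  refine h α β ?_
  -- As multisets the exponents of the two monomials agree, since `σ` only relabels the support.
  rw [← Multiset.coe_eq_coe, ← (Multiset.map_injective PNat.coe_injective).eq_iff,
    Multiset.map_coe, Multiset.map_coe, hα, hβ, coe_exps, coe_exps, Finsupp.support_embDomain,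
    Finset.map_val, Multiset.map_map]
  refine Multiset.map_congr rfl fun i _ => ?_
  exact Finsupp.embDomain_apply_self σ.toEmbedding m i

variable {H : Type*} [CommRing H] [HopfAlgebra ℂ H] [IsCocomm ℂ H]
variable (𝒜 : ℕ → Submodule ℂ H) [GradedAlgebra 𝒜] [ConnectedGraded 𝒜] (ζ : H →ₐ[ℂ] ℂ)

/-- Functionals on a cocommutative coalgebra commute under convolution, so `ζ_α` is unchanged when
the parts of `α` are permuted. -/
theorem univ_mem_Sym (x : H) : (univ 𝒜 ζ x : MvPowerSeries ℕ ℂ) ∈ Sym := by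
  refine mem_Sym_of_perm fun α β h => ?_
  rw [univ_repr, univ_repr]
  have h2 : compChar 𝒜 ζ α = compChar 𝒜 ζ β :=
    (h.map (charPart 𝒜 ζ)).prod_eq (M := WithConv (H →ₗ[ℂ] ℂ))
  rw [h2]

/-- The morphism from a cocommutative combinatorial Hopf algebra to `Sym`. -/
def univSym : H →ₐ[ℂ] Sym :=
  (QSym.val.comp (univ 𝒜 ζ)).codRestrict Sym (univ_mem_Sym 𝒜 ζ)

theorem incl_univSym (x : H) : Sym.incl (univSym 𝒜 ζ x) = univ 𝒜 ζ x := rfl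

/-- `Sym` is the terminal cocommutative combinatorial Hopf algebra. -/
theorem univSym_isUniqueMorphism :
    IsUniqueMorphism 𝒜 ζ Sym.grading zetaSym (univSym 𝒜 ζ).toLinearMap := by
  refine ⟨⟨.of_algHom _ (fun x => ?_) (fun x => ?_) fun n x hx => ?_, fun x => ?_⟩,
    fun g hg => ?_⟩
  · apply Sym.map_incl_injective
    rw [Sym.comul_incl, incl_univSym, univ_comul, TensorProduct.map_map]
    rfl
  · rw [Sym.counit_incl, incl_univSym, univ_counit]
  · exact univLinear_mem 𝒜 ζ hx
  · exact zetaQSym_univLinear 𝒜 ζ x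
  -- Uniqueness is inherited from `QSym`: followed by the injective inclusion, a competitor becomes
  -- a morphism to `QSym`.
  · have h : IsCombinatorialMorphism 𝒜 ζ QSym.grading zetaQSym (Sym.incl.toLinearMap ∘ₗ g) := by
      let F : H →ₐ[ℂ] QSym := Sym.incl.comp (AlgHom.ofLinearMap g hg.map_one hg.map_mul)
      refine ⟨.of_algHom F (fun x => ?_) (fun x => ?_) fun n x hx => hg.map_degree n x hx,
        fun x => hg.map_char x⟩
      · change comul (R := ℂ) (Sym.incl (g x)) = _
        rw [← Sym.comul_incl, hg.map_comul, TensorProduct.map_map]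
        rfl
      · exact (Sym.counit_incl (g x)).symm.trans (hg.map_counit x)
    have h2 := combinatorialMorphism_unique 𝒜 ζ h (univ_isCombinatorialMorphism 𝒜 ζ)
    ext x : 1
    exact Sym.incl_injective (congrArg (fun f => f x) h2)

end Cocommutative

end PeakTheta

namespace PeakTheta

open Coalgebra

/-! ### Power sums as primitive elements, and the theta maps on them. -/

section PowerSums

theorem M_singleton_mem (n : ℕ+) : M [n] ∈ QSym.grading n :=
  Submodule.subset_span ⟨[n], by simp [size], rfl⟩

theorem comul_M_singleton (n : ℕ+) :
    comul (R := ℂ) (M [n]) = M [n] ⊗ₜ 1 + 1 ⊗ₜ M [n] := by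
  rw [QSym.comul_M]
  simp [Finset.sum_range_succ, M_nil, add_comm]

theorem zetaQSym_M_singleton (n : ℕ+) : zetaQSym (M [n]) = 1 := by
  rw [← coord_singleton_eq_zeta (M_singleton_mem n), ← basisM_apply, basisM.repr_self,
    Finsupp.single_eq_same]

theorem incl_p (n : ℕ+) : Sym.incl (p n) = ((n : ℕ) : ℂ)⁻¹ • M [n] := rfl

theorem p_mem (n : ℕ+) : p n ∈ Sym.grading n := by
  rw [Sym.grading, Submodule.mem_comap]
  exact Submodule.smul_mem _ _ (M_singleton_mem n)

theorem comul_p (n : ℕ+) : comul (R := ℂ) (p n) = p n ⊗ₜ 1 + 1 ⊗ₜ p n := by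
  apply Sym.map_incl_injective
  rw [Sym.comul_incl, incl_p, map_smul, comul_M_singleton, map_add, TensorProduct.map_tmul,
    TensorProduct.map_tmul]
  simp only [AlgHom.toLinearMap_apply, map_one, incl_p, smul_add, TensorProduct.smul_tmul',
    TensorProduct.tmul_smul]

theorem zetaSym_p (n : ℕ+) : zetaSym (p n) = ((n : ℕ) : ℂ)⁻¹ := by
  rw [zetaSym, AlgHom.comp_apply, incl_p, map_smul, zetaQSym_M_singleton, smul_eq_mul, mul_one]

/-- The map `Θ_QSym` on the power sums. -/
theorem thetaQSym_M_singleton (n : ℕ+) :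
    univ QSym.grading (thetaChar QSym.grading zetaQSym) (M [n]) =
      (1 - (-1 : ℂ) ^ (n : ℕ)) • M [n] := by
  rw [univ_primitive _ _ (M_singleton_mem n) (comul_M_singleton n),
    thetaChar_primitive _ _ n.ne_zero (M_singleton_mem n) (comul_M_singleton n),
    zetaQSym_M_singleton, mul_one]

/-- The map `Θ_Sym` on the power sums. -/
theorem thetaSym_p (n : ℕ+) :
    univSym Sym.grading (thetaChar Sym.grading zetaSym) (p n) =
      (1 - (-1 : ℂ) ^ (n : ℕ)) • p n := by
  apply Sym.incl_injective
  -- The universal morphism yields a multiple of `M_{(n)}`, not of `p_n`; the missing factor `1/n`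
  -- is supplied by the value of `zetaSym` at `p_n`.
  rw [incl_univSym, univ_primitive _ _ (p_mem n) (comul_p n),
    thetaChar_primitive _ _ n.ne_zero (p_mem n) (comul_p n), zetaSym_p, map_smul, incl_p,
    smul_smul]

end PowerSums

/-! ### The theta map of `Sym(V)`. -/

section ThetaSymV

variable {ι V : Type*} [AddCommGroup V] [Module ℂ V] (v : Module.Basis ι ℂ V) (d : ι → ℕ+)

theorem linearMap_ext_word {W : Type*} [AddCommMonoid W] [Module ℂ W]
    {f g : SymmetricAlgebra ℂ V →ₗ[ℂ] W} (h : ∀ α, f (word v α) = g (word v α)) : f = g := by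
  refine v.symmetricAlgebra.ext fun m => ?_
  obtain ⟨α, rfl⟩ := exists_word m
  rw [← word_eq]
  exact h α

theorem symV_algHom_ext {A : Type*} [CommSemiring A] [Algebra ℂ A]
    {f g : SymmetricAlgebra ℂ V →ₐ[ℂ] A}
    (h : ∀ i, f (SymmetricAlgebra.ι ℂ V (v i)) = g (SymmetricAlgebra.ι ℂ V (v i))) : f = g :=
  SymmetricAlgebra.algHom_ext (v.ext h)

/-- Translates the scalar produced by the theta character into the parity condition on letters. -/
theorem one_sub_neg_one_pow (n : ℕ) [Decidable (Odd n)] :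
    (1 - (-1 : ℂ) ^ n) = if Odd n then 2 else 0 := by
  split_ifs with h
  · rw [h.neg_one_pow]
    norm_num
  · rw [(Nat.not_odd_iff_even.1 h).neg_one_pow, sub_self]

/-- `Θ_{Sym(V)}` as the morphism of algebras that multiplies `v_i` by `1 - (-1)^{deg v_i}`. -/
def thetaSymVHom : SymmetricAlgebra ℂ V →ₐ[ℂ] SymmetricAlgebra ℂ V :=
  SymmetricAlgebra.lift
    (v.constr ℂ fun i => (1 - (-1 : ℂ) ^ (d i : ℕ)) • SymmetricAlgebra.ι ℂ V (v i))

theorem thetaSymVHom_ι (i : ι) : thetaSymVHom v d (SymmetricAlgebra.ι ℂ V (v i)) =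
    (1 - (-1 : ℂ) ^ (d i : ℕ)) • SymmetricAlgebra.ι ℂ V (v i) := by
  simp [thetaSymVHom]

theorem word_cons (i : ι) (α : List ι) :
    word v (i :: α) = SymmetricAlgebra.ι ℂ V (v i) * word v α := by
  simp [word]

/-- A single letter of even degree contributes the factor `0` and kills the word; otherwise each
letter contributes `2`. This is why the map given on monomials is multiplicative. -/
theorem thetaSymVHom_toLinearMap : (thetaSymVHom v d).toLinearMap = thetaSymV v d := by
  classical
  refine linearMap_ext_word v fun α => ?_
  rw [thetaSymV_word, AlgHom.toLinearMap_apply]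
  induction α with
  | nil => simp [word]
  | cons i α ih =>
    rw [word_cons, map_mul, ih, thetaSymVHom_ι, one_sub_neg_one_pow]
    simp only [List.forall_mem_cons]
    by_cases h1 : Odd (d i : ℕ)
    · by_cases h2 : ∀ j ∈ α, Odd (d j : ℕ)
      · rw [if_pos h1, if_pos h2, if_pos ⟨h1, h2⟩, smul_mul_smul_comm,
          List.length_cons, pow_succ']
      · simp [h2]
    · simp [h1]

/-- By multiplicativity, the coproduct and the counit need checking only on the `v_i`, which are
sent to multiples of themselves and so stay primitive. -/
theorem thetaSymV_isGradedHopfMorphism :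
    IsGradedHopfMorphism (symVGrading v d) (symVGrading v d) (thetaSymV v d) := by
  rw [← thetaSymVHom_toLinearMap]
  refine .of_algHom _ (fun x => ?_) (fun x => ?_) fun n x hx => ?_
  · have h : (Bialgebra.comulAlgHom ℂ (SymmetricAlgebra ℂ V)).comp (thetaSymVHom v d) =
        (Algebra.TensorProduct.map (thetaSymVHom v d) (thetaSymVHom v d)).comp
          (Bialgebra.comulAlgHom ℂ _) := by
      refine symV_algHom_ext v fun i => ?_
      simp [thetaSymVHom_ι, TensorProduct.smul_tmul', smul_add]
    exact congrArg (fun f => f x) h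
  · have h : (Bialgebra.counitAlgHom ℂ (SymmetricAlgebra ℂ V)).comp (thetaSymVHom v d) =
        Bialgebra.counitAlgHom ℂ _ := by
      refine symV_algHom_ext v fun i => ?_
      simp [thetaSymVHom_ι, SymmetricAlgebra.algebraMapInv_ι]
    exact congrArg (fun f => f x) h
  · classical
    -- For degrees the description on words is more convenient: each word goes to a multiple of
    -- itself.
    rw [← AlgHom.toLinearMap_apply, thetaSymVHom_toLinearMap]
    refine (Submodule.span_le (p := (symVGrading v d n).comap (thetaSymV v d))).2 ?_ hx
    rintro _ ⟨α, rfl, rfl⟩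
    rw [SetLike.mem_coe, Submodule.mem_comap, thetaSymV_word]
    split_ifs
    · exact Submodule.smul_mem _ _ (word_mem_symVGrading v d α)
    · exact Submodule.zero_mem _

theorem range_thetaSymV : LinearMap.range (thetaSymV v d) = symOdd v d := by
  classical
  apply le_antisymm
  · have hspan : Submodule.span ℂ (Set.range (word v)) = ⊤ := by
      rw [eq_top_iff, ← v.symmetricAlgebra.span_eq]
      refine Submodule.span_mono ?_
      rintro _ ⟨m, rfl⟩
      obtain ⟨α, rfl⟩ := exists_word m
      exact ⟨α, word_eq v α⟩
    rw [LinearMap.range_eq_map, ← hspan, Submodule.map_span, Submodule.span_le]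
    rintro _ ⟨_, ⟨α, rfl⟩, rfl⟩
    rw [thetaSymV_word]
    split_ifs with h
    · exact Submodule.smul_mem _ _ (Submodule.subset_span ⟨α, h, rfl⟩)
    · exact Submodule.zero_mem _
  · refine Submodule.span_le.2 ?_
    rintro _ ⟨α, h, rfl⟩
    -- On odd words `Θ_{Sym(V)}` is multiplication by the invertible scalar `2^ℓ`, so dividing by it
    -- gives a preimage.
    refine ⟨((2 : ℂ) ^ α.length)⁻¹ • word v α, ?_⟩
    rw [map_smul, thetaSymV_word, if_pos h, smul_smul, inv_mul_cancel₀ (pow_ne_zero _ two_ne_zero), one_smul]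

theorem phiSymV_ι (i : ι) : phiSymV v d (SymmetricAlgebra.ι ℂ V (v i)) = p (d i) := by
  simp [phiSymV]

theorem zetaSymV_ι (i : ι) :
    zetaSymV v d (SymmetricAlgebra.ι ℂ V (v i)) = ((d i : ℕ) : ℂ)⁻¹ := by
  simp [zetaSymV]

/-- Both composites are algebra morphisms that send `v_i` to `1 - (-1)^n` times `p_n`, where `n =
deg v_i`. -/
theorem thetaSym_comp_phiSymV :
    (univSym Sym.grading (thetaChar Sym.grading zetaSym)).toLinearMap ∘ₗ
        (phiSymV v d).toLinearMap = (phiSymV v d).toLinearMap ∘ₗ thetaSymV v d := by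
  rw [← thetaSymVHom_toLinearMap]
  have h : (univSym Sym.grading (thetaChar Sym.grading zetaSym)).comp (phiSymV v d) =
      (phiSymV v d).comp (thetaSymVHom v d) := by
    refine symV_algHom_ext v fun i => ?_
    rw [AlgHom.comp_apply, AlgHom.comp_apply, thetaSymVHom_ι, map_smul, phiSymV_ι, thetaSym_p]
  exact congrArg AlgHom.toLinearMap h

/-- The choice of `1 / deg v_i` for the character makes the universal morphism send `v_i` to the
image of `p_{deg v_i}` in `QSym`, in agreement with `phiSymV`. -/
theorem univ_ι (i : ι) :
    univ (symVGrading v d) (zetaSymV v d) (SymmetricAlgebra.ι ℂ V (v i)) =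
      ((d i : ℕ) : ℂ)⁻¹ • M [d i] := by
  have hi : SymmetricAlgebra.ι ℂ V (v i) ∈ symVGrading v d (d i) :=
    Submodule.subset_span ⟨[i], by simp [wordDegree], by simp [word]⟩
  rw [univ_primitive _ _ hi (SymmetricAlgebra.comul_ι ℂ V (v i)), zetaSymV_ι]

/-- Terminality supplies both `Φ` and `Θ_QSym`. The intertwining identity is checked on the `v_i`,
where both theta maps scale by the same parity factor. -/
theorem thetaSymV_isThetaMap : IsThetaMap (symVGrading v d) (zetaSymV v d) (thetaSymV v d) := by
  refine ⟨thetaSymV_isGradedHopfMorphism v d, _, _,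
    univ_isUniqueMorphism (symVGrading v d) (zetaSymV v d),
    univ_isUniqueMorphism QSym.grading (thetaChar QSym.grading zetaQSym), ?_⟩
  rw [← thetaSymVHom_toLinearMap]
  have h : (univ QSym.grading (thetaChar QSym.grading zetaQSym)).comp
        (univ (symVGrading v d) (zetaSymV v d)) =
      (univ (symVGrading v d) (zetaSymV v d)).comp (thetaSymVHom v d) := by
    refine symV_algHom_ext v fun i => ?_
    rw [AlgHom.comp_apply, AlgHom.comp_apply, thetaSymVHom_ι, map_smul, univ_ι, map_smul,
      thetaQSym_M_singleton, smul_comm]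
  exact congrArg AlgHom.toLinearMap h

end ThetaSymV

end PeakTheta

end

theorem mainTheorem6 {ι V : Type*} [AddCommGroup V] [Module ℂ V] (v : Module.Basis ι ℂ V)
    (d : ι → ℕ+) (hfin : ∀ n : ℕ, {α : List ι | PeakTheta.wordDegree d α = n}.Finite) :
    PeakTheta.IsGradedHopfMorphism (PeakTheta.symVGrading v d) (PeakTheta.symVGrading v d)
      (PeakTheta.thetaSymV v d) ∧
    LinearMap.range (PeakTheta.thetaSymV v d) = PeakTheta.symOdd v d ∧
    (∃ ΘSym : PeakTheta.Sym →ₗ[ℂ] PeakTheta.Sym,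
      PeakTheta.IsUniqueMorphism
        PeakTheta.Sym.grading (PeakTheta.thetaChar PeakTheta.Sym.grading PeakTheta.zetaSym)
        PeakTheta.Sym.grading PeakTheta.zetaSym ΘSym ∧
      ΘSym ∘ₗ (PeakTheta.phiSymV v d).toLinearMap =
        (PeakTheta.phiSymV v d).toLinearMap ∘ₗ PeakTheta.thetaSymV v d ∧
      (PeakTheta.symOdd v d).map (PeakTheta.phiSymV v d).toLinearMap ≤ LinearMap.range ΘSym) ∧
    PeakTheta.IsThetaMap (PeakTheta.symVGrading v d) (PeakTheta.zetaSymV v d)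
      (PeakTheta.thetaSymV v d) ∧
    PeakTheta.IsPeakAlgebra (PeakTheta.symVGrading v d) (PeakTheta.zetaSymV v d)
      (PeakTheta.symOdd v d) := by
  refine ⟨PeakTheta.thetaSymV_isGradedHopfMorphism v d, PeakTheta.range_thetaSymV v d,
    ⟨_, PeakTheta.univSym_isUniqueMorphism _ _, PeakTheta.thetaSym_comp_phiSymV v d, ?_⟩,
    PeakTheta.thetaSymV_isThetaMap v d,
    _, PeakTheta.thetaSymV_isThetaMap v d, (PeakTheta.range_thetaSymV v d).symm⟩
  -- As `Sym(O(V))` is the image of `Θ_{Sym(V)}`, its image under `Φ_{Sym(V)}` is the range of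
  -- `Θ_Sym ∘ Φ_{Sym(V)}`, which lies in `Ω`.
  rw [← PeakTheta.range_thetaSymV, ← LinearMap.range_comp, ← PeakTheta.thetaSym_comp_phiSymV]
  exact LinearMap.range_comp_le_range _ _
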